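/- **Universal Coefficient Theorem for Homology of Arbitrary Complexes.** Let $\Lambda$ be a ring with identity, $\mathbf C$ an arbitrary ($\mathbb Z$-indexed) chain complex of right $\Lambda$-modules with differentials $d_n: C_n\to C_{n-1}$, and $n\in\mathbb Z$. Put $B_n=\operatorname{Im} d_{n+1}$ and consider the additive functor $F=\mathrm H_n(\mathbf C\otimes_\Lambda -)$ from left $\Lambda$-modules to abelian groups. For an additive functor $F$ from left $\Lambda$-modules to abelian groups, write $L_iF$ for its left-derived functors, $\lambda_F:L_0F\to F$ for the canonical transformation, and $\underline F=\operatorname{Coker}\lambda_F$ for its quot-stabilization. Choose a projective resolution $P_\bullet\to X$ of each left module $X$, put $\Omega^0X=X$, $\Omega^{i}X=\operatorname{Im}(P_{i}\to P_{i-1})$ for $i\ge 1$, and $S_iF(X)=\operatorname{Ker}\big(F(\Omega^iX)\to F(P_{i-1})\big)$ for $i\ge 1$ (the left satellites). The left fundamental sequence of $F$ is the sequence of functors $$\cdots\to L_1F\to S_1F\to\underline F\circ\Omega\to L_0F\xrightarrow{\lambda_F}F\to\underline F\to 0$$ with rows $L_iF\to S_iF\to\underline F\circ\Omega^i$ and connecting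 maps $\underline F\circ\Omega^{i+1}\to L_iF$. Here $L_iF\to S_iF$ ($i\ge1$) is induced by $F(P_i)\to F(\Omega^iX)$, the map $S_iF\to\underline F\circ\Omega^i$ is the inclusion into $F(\Omega^i X)$ followed by the projection, and $\underline F\circ\Omega^{i+1}\to L_iF$ is induced by $F(\Omega^{i+1}X)\to F(P_i)$. Then, for $F=\mathrm H_n(\mathbf C\otimes_\Lambda-)$ and for every choice of projective resolutions: 1. There are exact sequences of functors $$0\to F\xrightarrow{\iota} C_n/B_n\otimes-\to C_{n-1}\otimes-\to C_{n-1}/B_{n-1}\otimes-\to0,$$ $$0\to\underline F\xrightarrow{\iota'} B_{n-1}\otimes-\to C_{n-1}\otimes-\to C_{n-1}/B_{n-1}\otimes-\to0,$$ in which the maps between tensor products are induced by the differential, the inclusion and the projection, $\iota$ sends the class of a cycle to its image in $C_n/B_n\otimes-$, and $\iota'$ is induced by $\iota$ and the map $C_n/B_n\to B_{n-1}$. 2. There is a natural transformation $\kappa:\mathrm H_n(\mathbf C)\otimes-\to F$ whose composition with $\iota$ is induced by the inclusion $\mathrm H_n(\mathbf C)\to C_n/B_n$. It factors through $\lambda_F$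 by an isomorphism $\mathrm H_n(\mathbf C)\otimes-\cong L_0F$, and $L_i\kappa:\operatorname{Tor}_i(\mathrm H_n(\mathbf C),-)\to L_iF$ is an isomorphism for each $i\ge1$. 3. Under these identifications, the left fundamental sequence of $F$ takes the form $$\cdots\to \operatorname{Tor}_1(\mathrm H_n(\mathbf C),-)\to S_1F\to\underline F\circ\Omega\to \mathrm H_n(\mathbf C)\otimes-\xrightarrow{\kappa}F\to\underline F\to0,$$ with rows $\operatorname{Tor}_i(\mathrm H_n(\mathbf C),-)\to S_iF\to\underline F\circ\Omega^i$ for $i\ge1$. It is a complex, and it is exact except, possibly, at the terms $\mathrm H_n(\mathbf C)\otimes-$ and $\operatorname{Tor}_i(\mathrm H_n(\mathbf C),-)$, $i\ge1$. If $F$ is half-exact (for every short exact sequence $0\to X\to Y\to Z\to0$ the sequence $F(X)\to F(Y)\to F(Z)$ is exact), then the whole sequence is exact. -/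

import Mathlib

open CategoryTheory CategoryTheory.Limits

universe v v' u u'

set_option linter.unusedSectionVars false

noncomputable section

namespace FundamentalSequence

section Sequences

/-- A long sequence in the shape
`⋯ ⟶ U (i+1) ⟶ L i ⟶ S i ⟶ U i ⟶ ⋯ ⟶ U 1 ⟶ L 0 ⟶ S 0 ⟶ U 0 ⟶ 0`
(only the data: nothing is assumed about compositions). -/
structure LongSequence (V : Type u) [Category.{v} V] where
  L : ℕ → V
  S : ℕ → V
  U : ℕ → V
  l : ∀ i, L i ⟶ S i
  s : ∀ i, S i ⟶ U i
  a : ∀ i, U (i + 1) ⟶ L i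

variable {V : Type u} [Category.{v} V] [Abelian V]

/-- `X ⟶ Y ⟶ Z` composes to zero and is exact at `Y`. -/
def ExactPair {X Y Z : V} (f : X ⟶ Y) (g : Y ⟶ Z) : Prop :=
  ∃ w : f ≫ g = 0, (ShortComplex.mk f g w).Exact

/-- The four-term sequence `0 ⟶ W ⟶ X ⟶ Y ⟶ Z ⟶ 0` is exact. -/
def ExactFour {W X Y Z : V} (f : W ⟶ X) (g : X ⟶ Y) (h : Y ⟶ Z) : Prop :=
  Mono f ∧ ExactPair f g ∧ ExactPair g h ∧ Epi h

namespace LongSequence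

/-- All compositions of two consecutive maps vanish. -/
def IsComplex (E : LongSequence V) : Prop :=
  ∀ i, E.a i ≫ E.l i = 0 ∧ E.l i ≫ E.s i = 0 ∧ E.s (i + 1) ≫ E.a i = 0

/-- Exactness at all the terms `S i` and `U i` (at `U 0` this means that `S 0 ⟶ U 0` is epic). -/
def ExactOffL (E : LongSequence V) : Prop :=
  (∀ i, ExactPair (E.l i) (E.s i)) ∧ (∀ i, ExactPair (E.s (i + 1)) (E.a i)) ∧ Epi (E.s 0)

/-- Exactness at all the terms. -/
def IsExact (E : LongSequence V) : Prop :=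
  E.ExactOffL ∧ ∀ i, ExactPair (E.a i) (E.l i)

/-- Replace the terms `L i` by isomorphic objects. -/
def replaceL (E : LongSequence V) (L' : ℕ → V) (e : ∀ i, L' i ≅ E.L i) : LongSequence V where
  L := L'
  S := E.S
  U := E.U
  l i := (e i).hom ≫ E.l i
  s := E.s
  a i := E.a i ≫ (e i).inv

end LongSequence

end Sequences

section Syzygies

variable {A : Type u} [Category.{v} A] [Abelian A]

/-- The object in the epi-mono factorization `K (i+1) ↠ ΩK ↪ K i` of the differential of `K`.
For a projective resolution of `B` this is the syzygy object `Ω^(i+1) B`. -/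
abbrev syz (K : ChainComplex A ℕ) (i : ℕ) : A := image (K.d (i + 1) i)

/-- The inclusion `m : Ω^(i+1) B ⟶ P i`. -/
abbrev syzι (K : ChainComplex A ℕ) (i : ℕ) : syz K i ⟶ K.X i := image.ι (K.d (i + 1) i)

/-- The projection `e : P (i+1) ⟶ Ω^(i+1) B`. -/
abbrev syzπ (K : ChainComplex A ℕ) (i : ℕ) : K.X (i + 1) ⟶ syz K i :=
  factorThruImage (K.d (i + 1) i)

lemma syzπ_ι (K : ChainComplex A ℕ) (i : ℕ) : syzπ K i ≫ syzι K i = K.d (i + 1) i :=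
  image.fac _

lemma syzι_d (K : ChainComplex A ℕ) (i j : ℕ) : syzι K i ≫ K.d i j = 0 := by
  rw [← cancel_epi (syzπ K i), ← Category.assoc, syzπ_ι, K.d_comp_d, comp_zero]

lemma d_syzπ (K : ChainComplex A ℕ) (i j : ℕ) : K.d j (i + 1) ≫ syzπ K i = 0 := by
  rw [← cancel_mono (syzι K i), Category.assoc, syzπ_ι, K.d_comp_d, zero_comp]

/-- The map on syzygies induced by a chain map. -/
def syzMap {K K' : ChainComplex A ℕ} (φ : K ⟶ K') (i : ℕ) : syz K i ⟶ syz K' i :=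
  image.map (Arrow.homMk (f := Arrow.mk (K.d (i + 1) i)) (g := Arrow.mk (K'.d (i + 1) i))
    (φ.f (i + 1)) (φ.f i) (φ.comm (i + 1) i))

lemma syzMap_ι {K K' : ChainComplex A ℕ} (φ : K ⟶ K') (i : ℕ) :
    syzMap φ i ≫ syzι K' i = syzι K i ≫ φ.f i :=
  image.map_ι _

lemma syzπ_map {K K' : ChainComplex A ℕ} (φ : K ⟶ K') (i : ℕ) :
    syzπ K i ≫ syzMap φ i = φ.f (i + 1) ≫ syzπ K' i := by
  rw [← cancel_mono (syzι K' i), Category.assoc, syzMap_ι, Category.assoc, syzπ_ι,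
    ← Category.assoc, syzπ_ι, φ.comm]

lemma syzMap_id (K : ChainComplex A ℕ) (i : ℕ) : syzMap (𝟙 K) i = 𝟙 _ := by
  rw [← cancel_mono (syzι K i), syzMap_ι]; simp

lemma syzMap_comp {K K' K'' : ChainComplex A ℕ} (φ : K ⟶ K') (ψ : K' ⟶ K'') (i : ℕ) :
    syzMap (φ ≫ ψ) i = syzMap φ i ≫ syzMap ψ i := by
  rw [← cancel_mono (syzι K'' i), syzMap_ι, Category.assoc, syzMap_ι, ← Category.assoc, syzMap_ι]
  simp

/-- Homotopic chain maps induce the same map on syzygies up to a map that factors through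
the inclusion `Ω^(i+1) B ⟶ P i`. -/
lemma syzMap_homotopy {K K' : ChainComplex A ℕ} {φ ψ : K ⟶ K'} (h : Homotopy φ ψ) (i : ℕ) :
    syzMap φ i = syzMap ψ i + syzι K i ≫ h.hom i (i + 1) ≫ syzπ K' i := by
  have key : syzι K i ≫ dNext i h.hom = 0 := by
    cases i with
    | zero => rw [Homotopy.dNext_zero_chainComplex, comp_zero]
    | succ j => rw [Homotopy.dNext_succ_chainComplex, ← Category.assoc, syzι_d, zero_comp]
  rw [← cancel_mono (syzι K' i), Preadditive.add_comp, syzMap_ι, syzMap_ι, h.comm i,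
    Preadditive.comp_add, Preadditive.comp_add, key, Homotopy.prevD_chainComplex]
  simp only [Category.assoc, syzπ_ι]
  abel

end Syzygies

section Homology

variable {D : Type u'} [Category.{v'} D] [Abelian D]

/-- If the differential `K (i+1) ⟶ K i` factors as `m ∘ e`, then `e` sends cycles into the kernel
of `m`. -/
def homologyToKernel (K : ChainComplex D ℕ) (i : ℕ) {Y : D} (e : K.X (i + 1) ⟶ Y)
    (m : Y ⟶ K.X i) (he : K.d (i + 2) (i + 1) ≫ e = 0) (hm : e ≫ m = K.d (i + 1) i) :
    K.homology (i + 1) ⟶ kernel m :=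
  kernel.lift m (K.homologyι (i + 1) ≫ K.descOpcycles e (i + 2) (by simp) he) (by
    have : K.descOpcycles e (i + 2) (by simp) he ≫ m = K.fromOpcycles (i + 1) i := by
      rw [← cancel_epi (K.pOpcycles (i + 1)), HomologicalComplex.p_descOpcycles_assoc, hm,
        HomologicalComplex.p_fromOpcycles]
    rw [Category.assoc, this, HomologicalComplex.homologyι_comp_fromOpcycles])

lemma homologyπ_homologyToKernel_ι (K : ChainComplex D ℕ) (i : ℕ) {Y : D} (e : K.X (i + 1) ⟶ Y)
    (m : Y ⟶ K.X i) (he : K.d (i + 2) (i + 1) ≫ e = 0) (hm : e ≫ m = K.d (i + 1) i) :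
    K.homologyπ (i + 1) ≫ homologyToKernel K i e m he hm ≫ kernel.ι m =
      K.iCycles (i + 1) ≫ e := by
  simp [homologyToKernel]

lemma homologyToKernel_naturality {K K' : ChainComplex D ℕ} (φ : K ⟶ K') (i : ℕ) {Y Y' : D}
    (g : Y ⟶ Y') {e : K.X (i + 1) ⟶ Y} {m : Y ⟶ K.X i} {e' : K'.X (i + 1) ⟶ Y'}
    {m' : Y' ⟶ K'.X i} (he : K.d (i + 2) (i + 1) ≫ e = 0) (hm : e ≫ m = K.d (i + 1) i)
    (he' : K'.d (i + 2) (i + 1) ≫ e' = 0) (hm' : e' ≫ m' = K'.d (i + 1) i)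
    (h : e ≫ g = φ.f (i + 1) ≫ e') (h' : g ≫ m' = m ≫ φ.f i) :
    HomologicalComplex.homologyMap φ (i + 1) ≫ homologyToKernel K' i e' m' he' hm' =
      homologyToKernel K i e m he hm ≫ kernel.map m m' g (φ.f i) h'.symm := by
  rw [← cancel_epi (K.homologyπ (i + 1)), ← cancel_mono (kernel.ι m')]
  simp only [Category.assoc, HomologicalComplex.homologyπ_naturality_assoc,
    homologyπ_homologyToKernel_ι, HomologicalComplex.cyclesMap_i_assoc, kernel.lift_ι]
  rw [← Category.assoc (homologyToKernel K i e m he hm), ← Category.assoc (K.homologyπ _),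
    homologyπ_homologyToKernel_ι, Category.assoc, h]

/-- A map into `K i` that is killed by the differential, followed by passage to homology. -/
def cycleToHomology (K : ChainComplex D ℕ) (i : ℕ) {Y : D} (m : Y ⟶ K.X i)
    (hm : m ≫ K.d i ((ComplexShape.down ℕ).next i) = 0) : Y ⟶ K.homology i :=
  K.liftCycles m _ rfl hm ≫ K.homologyπ i

lemma cycleToHomology_ι (K : ChainComplex D ℕ) (i : ℕ) {Y : D} (m : Y ⟶ K.X i)
    (hm : m ≫ K.d i ((ComplexShape.down ℕ).next i) = 0) :
    cycleToHomology K i m hm ≫ K.homologyι i = m ≫ K.pOpcycles i := by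
  simp [cycleToHomology]

lemma comp_cycleToHomology (K : ChainComplex D ℕ) (i : ℕ) {Y : D} (e : K.X (i + 1) ⟶ Y)
    (m : Y ⟶ K.X i) (hm : m ≫ K.d i ((ComplexShape.down ℕ).next i) = 0)
    (h : e ≫ m = K.d (i + 1) i) : e ≫ cycleToHomology K i m hm = 0 := by
  rw [← cancel_mono (K.homologyι i), Category.assoc, cycleToHomology_ι, ← Category.assoc, h,
    K.d_pOpcycles, zero_comp]

lemma cycleToHomology_naturality {K K' : ChainComplex D ℕ} (φ : K ⟶ K') (i : ℕ) {Y Y' : D}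
    (g : Y ⟶ Y') {m : Y ⟶ K.X i} {m' : Y' ⟶ K'.X i}
    (hm : m ≫ K.d i ((ComplexShape.down ℕ).next i) = 0)
    (hm' : m' ≫ K'.d i ((ComplexShape.down ℕ).next i) = 0) (h : g ≫ m' = m ≫ φ.f i) :
    g ≫ cycleToHomology K' i m' hm' =
      cycleToHomology K i m hm ≫ HomologicalComplex.homologyMap φ i := by
  rw [← cancel_mono (K'.homologyι i), Category.assoc, cycleToHomology_ι, Category.assoc,
    HomologicalComplex.homologyι_naturality, ← Category.assoc, h, ← Category.assoc,
    cycleToHomology_ι, Category.assoc, Category.assoc, HomologicalComplex.p_opcyclesMap]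

end Homology

section LeftFundamentalSequence

variable {A : Type u} [Category.{v} A] [Abelian A] [HasProjectiveResolutions A]
  {D : Type u'} [Category.{v'} D] [Abelian D] (F : A ⥤ D) [F.Additive]

/-- The quot-stabilization of `F`: the cokernel of the canonical map from the zeroth
left-derived functor of `F` to `F`. -/
def quotStab : A ⥤ D where
  obj X := cokernel (F.fromLeftDerivedZero.app X)
  map f := cokernel.map _ _ ((F.leftDerived 0).map f) (F.map f)
    (F.fromLeftDerivedZero.naturality f).symm
  map_id X := by
    rw [← cancel_epi (cokernel.π (F.fromLeftDerivedZero.app X))]; simp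
  map_comp f g := by
    rw [← cancel_epi (cokernel.π (F.fromLeftDerivedZero.app _))]; simp

/-- The canonical projection `F ⟶ quotStab F`. -/
def quotStabπ : F ⟶ quotStab F where
  app X := cokernel.π (F.fromLeftDerivedZero.app X)
  naturality X Y f := by simp [quotStab]

instance (X : A) : Epi ((quotStabπ F).app X) := by
  exact (inferInstance : Epi (cokernel.π (F.fromLeftDerivedZero.app X)))

lemma quotStab_map_add {X Y : A} (f g : X ⟶ Y) :
    (quotStab F).map (f + g) = (quotStab F).map f + (quotStab F).map g := by
  rw [← cancel_epi ((quotStabπ F).app X), Preadditive.comp_add, ← NatTrans.naturality,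
    ← NatTrans.naturality, ← NatTrans.naturality, F.map_add, Preadditive.add_comp]

lemma quotStab_isZero (P : A) [Projective P] : IsZero ((quotStab F).obj P) := by
  dsimp [quotStab]
  exact isZero_cokernel_of_epi _

lemma map_quotStabπ {P X : A} [Projective P] (p : P ⟶ X) :
    F.map p ≫ (quotStabπ F).app X = 0 := by
  rw [(quotStabπ F).naturality, (quotStab_isZero F P).eq_of_tgt ((quotStabπ F).app P) 0, zero_comp]

/-- If `p : P ⟶ X` is an epimorphism with `P` projective, then a map from `F X` which vanishes
on `F P` vanishes on the zeroth left-derived functor. -/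
lemma fromLeftDerivedZero_comp_eq_zero {P X : A} [Projective P] (p : P ⟶ X) [Epi p] {T : D}
    (k : F.obj X ⟶ T) (hk : F.map p ≫ k = 0) : F.fromLeftDerivedZero.app X ≫ k = 0 := by
  have h : (projectiveResolution X).fromLeftDerivedZero' F ≫ k = 0 := by
    rw [← cancel_epi (HomologicalComplex.pOpcycles _ _),
      ProjectiveResolution.pOpcycles_comp_fromLeftDerivedZero'_assoc, comp_zero]
    have hp : ∀ q : (projectiveResolution X).complex.X 0 ⟶ X, F.map q ≫ k = 0 := fun q => by
      rw [← Projective.factorThru_comp q p, F.map_comp, Category.assoc, hk, comp_zero]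
    exact hp _
  rw [(projectiveResolution X).fromLeftDerivedZero_eq F]
  exact (Category.assoc _ _ _).trans ((congrArg (_ ≫ ·) ((Category.assoc _ _ _).trans
    ((congrArg (_ ≫ ·) h).trans comp_zero))).trans comp_zero)

variable (R : ∀ B : A, ProjectiveResolution B)

/-- The chain map between the chosen resolutions that lifts `f`. -/
abbrev resLift {B B' : A} (f : B ⟶ B') : (R B).complex ⟶ (R B').complex :=
  ProjectiveResolution.lift f (R B) (R B')

/-- The functor `quotStab F ∘ Ω^(i+1)`, with syzygies computed from the chosen resolutions. -/
def quotStabSyz (i : ℕ) : A ⥤ D where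
  obj B := (quotStab F).obj (syz (R B).complex i)
  map f := (quotStab F).map (syzMap (resLift R f) i)
  map_id B := by
    rw [syzMap_homotopy (ProjectiveResolution.liftIdHomotopy B (R B)) i, quotStab_map_add,
      syzMap_id, (quotStab F).map_id, (quotStab F).map_comp,
      (quotStab_isZero F ((R B).complex.X i)).eq_of_tgt ((quotStab F).map (syzι _ i)) 0,
      zero_comp, add_zero]
  map_comp {B B' B''} f g := by
    rw [syzMap_homotopy (ProjectiveResolution.liftCompHomotopy f g (R B) (R B') (R B'')) i,
      quotStab_map_add, syzMap_comp, (quotStab F).map_comp, (quotStab F).map_comp,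
      (quotStab_isZero F ((R B).complex.X i)).eq_of_tgt ((quotStab F).map (syzι _ i)) 0,
      zero_comp, add_zero]

/-- The left satellite `S_(i+1) F = S_1 F ∘ Ω^i`: its value at `B` is the kernel of
`F (Ω^(i+1) B) ⟶ F (P i)`. -/
def leftSatellite (i : ℕ) : A ⥤ D where
  obj B := kernel (F.map (syzι (R B).complex i))
  map {B B'} f := kernel.map _ _ (F.map (syzMap (resLift R f) i)) (F.map ((resLift R f).f i))
    (by rw [← F.map_comp, ← F.map_comp, syzMap_ι])
  map_id B := by
    rw [← cancel_mono (kernel.ι _), kernel.lift_ι,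
      syzMap_homotopy (ProjectiveResolution.liftIdHomotopy B (R B)) i, F.map_add, F.map_comp,
      Preadditive.comp_add, kernel.condition_assoc, zero_comp, add_zero, syzMap_id]
    simp
  map_comp {B B' B''} f g := by
    rw [← cancel_mono (kernel.ι _), kernel.lift_ι,
      syzMap_homotopy (ProjectiveResolution.liftCompHomotopy f g (R B) (R B') (R B'')) i,
      F.map_add, F.map_comp _ (_ ≫ _),
      Preadditive.comp_add, kernel.condition_assoc, zero_comp, add_zero, syzMap_comp]
    simp

/-- The map `S_(i+1) F ⟶ quotStab F ∘ Ω^(i+1)`: the inclusion into `F (Ω^(i+1) B)` followed by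
the projection onto the quot-stabilization. -/
def satelliteToQuotStab (i : ℕ) : leftSatellite F R i ⟶ quotStabSyz F R i where
  app B := kernel.ι (F.map (syzι (R B).complex i)) ≫ (quotStabπ F).app (syz (R B).complex i)
  naturality B B' f := by
    simp only [leftSatellite, quotStabSyz, kernel.lift_ι_assoc, Category.assoc]
    rw [(quotStabπ F).naturality]

/-- The complex `F P` for the chosen resolution `P` of `B`. -/
abbrev mapRes (B : A) : ChainComplex D ℕ := (F.mapHomologicalComplex _).obj (R B).complex

/-- The map of `F P`-complexes induced by `f`. -/
abbrev mapResLift {B B' : A} (f : B ⟶ B') : mapRes F R B ⟶ mapRes F R B' :=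
  (F.mapHomologicalComplex _).map (resLift R f)

lemma map_d_syzπ (i : ℕ) (B : A) :
    (mapRes F R B).d (i + 2) (i + 1) ≫ F.map (syzπ (R B).complex i) = 0 := by
  refine (F.map_comp _ _).symm.trans ?_
  exact (congrArg F.map (d_syzπ _ _ _)).trans (F.map_zero _ _)

lemma map_syzπ_ι (i : ℕ) (B : A) :
    F.map (syzπ (R B).complex i) ≫ F.map (syzι (R B).complex i) =
      (mapRes F R B).d (i + 1) i := by
  refine (F.map_comp _ _).symm.trans ?_
  rw [syzπ_ι]; rfl

lemma map_syzι_d (i j : ℕ) (B : A) :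
    F.map (syzι (R B).complex i) ≫ (mapRes F R B).d i j = 0 := by
  refine (F.map_comp _ _).symm.trans ?_
  exact (congrArg F.map (syzι_d _ _ _)).trans (F.map_zero _ _)

/-- The map `L_(i+1) F ⟶ S_(i+1) F`: the class of a cycle in `F (P (i+1))` goes to its image in
`F (Ω^(i+1) B)`, which lies in the kernel of `F (Ω^(i+1) B) ⟶ F (P i)`. -/
def derivedToSatellite (i : ℕ) : F.leftDerived (i + 1) ⟶ leftSatellite F R i where
  app B := ((R B).isoLeftDerivedObj F (i + 1)).hom ≫
    homologyToKernel (mapRes F R B) i (F.map (syzπ (R B).complex i))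
      (F.map (syzι (R B).complex i)) (map_d_syzπ F R i B) (map_syzπ_ι F R i B)
  naturality B B' f := by
    have h1 := ProjectiveResolution.isoLeftDerivedObj_hom_naturality f (R B) (R B')
      (resLift R f) (ProjectiveResolution.lift_commutes_zero f _ _) F (i + 1)
    have h2 := homologyToKernel_naturality (mapResLift F R f) i
      (F.map (syzMap (resLift R f) i))
      (map_d_syzπ F R i B) (map_syzπ_ι F R i B) (map_d_syzπ F R i B') (map_syzπ_ι F R i B')
      (by
        refine (F.map_comp _ _).symm.trans ?_
        rw [syzπ_map]; exact F.map_comp _ _)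
      (by
        refine (F.map_comp _ _).symm.trans ?_
        rw [syzMap_ι]; exact F.map_comp _ _)
    refine (Category.assoc _ _ _).symm.trans ?_
    refine (congrArg (· ≫ _) h1).trans ?_
    refine (Category.assoc _ _ _).trans ?_
    refine (congrArg (_ ≫ ·) h2).trans ?_
    exact (Category.assoc _ _ _).symm

/-- The map `quotStab F ∘ Ω^(i+1) ⟶ L_i F`: induced by sending an element of `F (Ω^(i+1) B)` to the
class of its image in `F (P i)`. -/
def quotStabToDerived (i : ℕ) : quotStabSyz F R i ⟶ F.leftDerived i where
  app B := cokernel.desc (F.fromLeftDerivedZero.app (syz (R B).complex i))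
      (cycleToHomology (mapRes F R B) i (F.map (syzι (R B).complex i)) (map_syzι_d F R i _ B))
      (fromLeftDerivedZero_comp_eq_zero F (syzπ (R B).complex i) _
        (comp_cycleToHomology (mapRes F R B) i (F.map (syzπ (R B).complex i))
          (F.map (syzι (R B).complex i)) _ (map_syzπ_ι F R i B))) ≫
    ((R B).isoLeftDerivedObj F i).inv
  naturality B B' f := by
    have h1 := ProjectiveResolution.isoLeftDerivedObj_inv_naturality f (R B) (R B')
      (resLift R f) (ProjectiveResolution.lift_commutes_zero f _ _) F i
    have h2 := cycleToHomology_naturality (mapResLift F R f) i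
      (F.map (syzMap (resLift R f) i)) (map_syzι_d F R i _ B) (map_syzι_d F R i _ B')
      (by
        refine (F.map_comp _ _).symm.trans ?_
        rw [syzMap_ι]; exact F.map_comp _ _)
    refine (cancel_epi (cokernel.π (F.fromLeftDerivedZero.app (syz (R B).complex i)))).1 ?_
    refine ((Category.assoc _ _ _).symm.trans (congrArg (· ≫ _)
      ((quotStabπ F).naturality (syzMap (resLift R f) i)).symm)).trans ?_
    refine (Category.assoc _ _ _).trans ?_
    refine (congrArg (_ ≫ ·) (cokernel.π_desc_assoc _ _ _ _)).trans ?_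
    refine (Category.assoc _ _ _).symm.trans ?_
    refine (congrArg (· ≫ _) h2).trans ?_
    refine (Category.assoc _ _ _).trans ?_
    refine (congrArg (_ ≫ ·) h1.symm).trans ?_
    refine ((Category.assoc _ _ _).symm.trans ?_)
    refine Eq.trans ?_ (congrArg (_ ≫ ·) (Category.assoc _ _ _).symm)
    refine Eq.trans ?_ (cokernel.π_desc_assoc _ _ _ _).symm
    exact Category.assoc _ _ _

/-- The left fundamental sequence of `F`, as a sequence of functors:
`⋯ ⟶ quotStab F ∘ Ω² ⟶ L_1 F ⟶ S_1 F ⟶ quotStab F ∘ Ω ⟶ L_0 F ⟶ F ⟶ quotStab F ⟶ 0`. -/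
def leftFundamentalSequence : LongSequence (A ⥤ D) where
  L i := F.leftDerived i
  S
    | 0 => F
    | i + 1 => leftSatellite F R i
  U
    | 0 => quotStab F
    | i + 1 => quotStabSyz F R i
  l
    | 0 => F.fromLeftDerivedZero
    | i + 1 => derivedToSatellite F R i
  s
    | 0 => quotStabπ F
    | i + 1 => satelliteToQuotStab F R i
  a i := quotStabToDerived F R i

/-- A functor is half-exact if it sends short exact sequences to sequences that are exact in
the middle. -/
def HalfExact : Prop :=
  ∀ T : ShortComplex A, T.ShortExact → (T.map F).Exact

end LeftFundamentalSequence

section Tensor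

open scoped TensorProduct MulOpposite

variable {Λ : Type u} [Ring Λ]

/-- The subgroup of `M ⊗_ℤ X` generated by the elements `(m λ) ⊗ x - m ⊗ (λ x)`. -/
def balancedRelations (M : ModuleCat.{u} Λᵐᵒᵖ) (X : ModuleCat.{u} Λ) : AddSubgroup (M ⊗[ℤ] X) :=
  AddSubgroup.closure
    {t | ∃ (m : M) (a : Λ) (x : X), t = (MulOpposite.op a • m) ⊗ₜ[ℤ] x - m ⊗ₜ[ℤ] (a • x)}

/-- The tensor product `M ⊗_Λ X` of a right `Λ`-module (a module over `Λᵐᵒᵖ`) and a left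
`Λ`-module. -/
abbrev Tens (M : ModuleCat.{u} Λᵐᵒᵖ) (X : ModuleCat.{u} Λ) : Type u :=
  (M ⊗[ℤ] X) ⧸ balancedRelations M X

/-- The map `f ⊗ g` on tensor products over `Λ`. -/
def tensMap {M M' : ModuleCat.{u} Λᵐᵒᵖ} {X X' : ModuleCat.{u} Λ} (f : M ⟶ M') (g : X ⟶ X') :
    Tens M X →+ Tens M' X' :=
  QuotientAddGroup.map _ _
    (TensorProduct.map f.hom.toAddMonoidHom.toIntLinearMap
      g.hom.toAddMonoidHom.toIntLinearMap).toAddMonoidHom (by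
    rw [balancedRelations, AddSubgroup.closure_le]
    rintro _ ⟨m, a, x, rfl⟩
    refine AddSubgroup.subset_closure ⟨f.hom m, a, g.hom x, ?_⟩
    simp)

/-- The element `m ⊗ x` of `M ⊗_Λ X`. -/
def tmk {M : ModuleCat.{u} Λᵐᵒᵖ} {X : ModuleCat.{u} Λ} (m : M) (x : X) : Tens M X :=
  QuotientAddGroup.mk (m ⊗ₜ[ℤ] x)

lemma tensMap_tmk {M M' : ModuleCat.{u} Λᵐᵒᵖ} {X X' : ModuleCat.{u} Λ} (f : M ⟶ M') (g : X ⟶ X')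
    (m : M) (x : X) : tensMap f g (tmk m x) = tmk (f.hom m) (g.hom x) := rfl

lemma tens_hom_ext {M : ModuleCat.{u} Λᵐᵒᵖ} {X : ModuleCat.{u} Λ} {G : Type*} [AddCommGroup G]
    {f g : Tens M X →+ G} (h : ∀ m x, f (tmk m x) = g (tmk m x)) : f = g := by
  refine DFunLike.ext f g fun q => ?_
  obtain ⟨t, rfl⟩ := QuotientAddGroup.mk_surjective q
  induction t using TensorProduct.induction_on with
  | zero => simp
  | tmul m x => exact h m x
  | add a b ha hb => rw [QuotientAddGroup.mk_add, map_add, map_add, ha, hb]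

lemma tmk_add_left {M : ModuleCat.{u} Λᵐᵒᵖ} {X : ModuleCat.{u} Λ} (m m' : M) (x : X) :
    tmk (m + m') x = tmk m x + tmk m' x := by
  rw [tmk, TensorProduct.add_tmul]; rfl

lemma tmk_add_right {M : ModuleCat.{u} Λᵐᵒᵖ} {X : ModuleCat.{u} Λ} (m : M) (x x' : X) :
    tmk m (x + x') = tmk m x + tmk m x' := by
  rw [tmk, TensorProduct.tmul_add]; rfl

variable (Λ) in
/-- The bifunctor `(M, X) ↦ M ⊗_Λ X`. -/
def tensorFunctor : ModuleCat.{u} Λᵐᵒᵖ ⥤ ModuleCat.{u} Λ ⥤ AddCommGrpCat.{u} where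
  obj M :=
    { obj X := AddCommGrpCat.of (Tens M X)
      map g := AddCommGrpCat.ofHom (tensMap (𝟙 M) g)
      map_id X := by
        ext1
        exact tens_hom_ext fun _ _ => rfl
      map_comp f g := by
        ext1
        exact tens_hom_ext fun _ _ => rfl }
  map f :=
    { app X := AddCommGrpCat.ofHom (tensMap f (𝟙 X))
      naturality X Y g := by
        ext1
        exact tens_hom_ext fun _ _ => rfl }
  map_id M := by
    ext X : 3
    exact tens_hom_ext fun _ _ => rfl
  map_comp f g := by
    ext X : 3
    exact tens_hom_ext fun _ _ => rfl

instance : (tensorFunctor Λ).Additive where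
  map_add {M M' f g} := by
    ext X : 3
    exact tens_hom_ext fun m x => tmk_add_left (f.hom m) (g.hom m) x

instance (M : ModuleCat.{u} Λᵐᵒᵖ) : ((tensorFunctor Λ).obj M).Additive where
  map_add {X X' f g} := by
    ext1
    exact tens_hom_ext fun m x => tmk_add_right m (f.hom x) (g.hom x)

instance (X : ModuleCat.{u} Λ) : ((tensorFunctor Λ).flip.obj X).Additive where
  map_add {M M' f g} := by
    ext1
    exact tens_hom_ext fun m x => tmk_add_left (f.hom m) (g.hom m) x

/-- The functor `M ⊗_Λ -` for `i = 0`, and `Tor_i(M, -)` for `i ≥ 1`. -/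
def torFunctor (M : ModuleCat.{u} Λᵐᵒᵖ) : ℕ → ModuleCat.{u} Λ ⥤ AddCommGrpCat.{u}
  | 0 => (tensorFunctor Λ).obj M
  | i + 1 => ((tensorFunctor Λ).obj M).leftDerived (i + 1)

variable (C : ChainComplex (ModuleCat.{u} Λᵐᵒᵖ) ℤ) (n : ℤ)

/-- The functor `X ↦ C ⊗_Λ X` to complexes of abelian groups. -/
def complexTensor : ModuleCat.{u} Λ ⥤ ChainComplex AddCommGrpCat.{u} ℤ where
  obj X := (((tensorFunctor Λ).flip.obj X).mapHomologicalComplex _).obj C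
  map g := (NatTrans.mapHomologicalComplex ((tensorFunctor Λ).flip.map g) _).app C

instance : (complexTensor C).Additive where
  map_add {X X' f g} := by
    ext1 i
    exact ((tensorFunctor Λ).obj (C.X i)).map_add

/-- The functor `X ↦ H_n(C ⊗_Λ X)`. -/
def homologyTensor : ModuleCat.{u} Λ ⥤ AddCommGrpCat.{u} :=
  complexTensor C ⋙ HomologicalComplex.homologyFunctor _ _ n

instance : (homologyTensor C n).Additive := by
  unfold homologyTensor; infer_instance

/-- The boundaries `B_(n-1)`, the image of `d : C_n ⟶ C_(n-1)`. -/
abbrev boundaries : ModuleCat.{u} Λᵐᵒᵖ := image (C.d n (n - 1))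

/-- The epimorphism `C_n / B_n ⟶ B_(n-1)` induced by the differential. (Mathlib's `C.opcycles n`
is the quotient `C_n / B_n`.) -/
def opcyclesToBoundaries : C.opcycles n ⟶ boundaries C n :=
  C.descOpcycles (factorThruImage (C.d n (n - 1))) (n + 1) (by simp) (by
    rw [← cancel_mono (image.ι (C.d n (n - 1))), Category.assoc, image.fac, C.d_comp_d, zero_comp])

end Tensor

end FundamentalSequence

end

open FundamentalSequence

/-! The fundamental sequence is treated for an arbitrary additive `F`. Let `P` be the chosen
resolution of `B`, with each differential factored as `e ≫ m` through a syzygy, `e` epic and `m`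
monic. Computing `L_i F` from `F P` turns every term into a kernel, cokernel or homology object
built from `F e` and `F m`. The decisive fact is `exactPair_map_quotStabπ`: the quot-stabilization
at `Ω^(i+1) B` is the cokernel of `F e`. Exactness at the satellites and at the quot-stabilizations
is then a diagram chase that uses no exactness of `F` (`exactPair_homologyToKernel`,
`exactPair_kernel_ι_comp`). At `L_i` one compares the elements of `F P_i` killed in `F (Ω^i B)` with
those coming from `F (Ω^(i+1) B)`. They agree when `F` is exact in the middle on `0 ⟶ Ω^(i+1) B ⟶
P_i ⟶ Ω^i B ⟶ 0`, which is where half-exactness enters.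

For `F = H_n(C ⊗ -)`, right exactness of the tensor product identifies the opcycles of `C ⊗ X` with
`C_n/B_n ⊗ X` (`opcyclesTensor`). Homology is the kernel of the map from opcycles to `C_(n-1) ⊗ X`,
which gives the first sequence, and `κ` is the lift of `H_n(C) ⊗ - ⟶ C_n/B_n ⊗ -` to that kernel.
Projective modules are flat, so `κ` is invertible on them (`isIso_tensorHomology_app`), hence all
`L_i κ` are isomorphisms. As `H_n(C) ⊗ -` is right exact, it is its own `L_0`, and `L_0 F ≅ H_n(C) ⊗
-` follows. The quot-stabilization is therefore the cokernel of `κ`. Dividing `C_n/B_n ⊗ -` by the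
image of `H_n(C) ⊗ -` gives `B_(n-1) ⊗ -`, and the first sequence descends to the second
(`exists_exactFour_of_cokernel`). -/

noncomputable section
namespace FundamentalSequence

/-! ### Exactness by generalized elements, pointwise exactness, and transport along isomorphisms. -/

section Pointwise

variable {V : Type u} [Category.{v} V] [Abelian V]

/-- Maps `T ⟶ Y` serve as elements of `Y`; a preimage exists only after an epimorphism onto `T`.
This is the language of the later diagram chases. -/
lemma ExactPair.up_to_refinements {X Y Z : V} {f : X ⟶ Y} {g : Y ⟶ Z} (h : ExactPair f g)
    {T : V} (y : T ⟶ Y) (hy : y ≫ g = 0) :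
    ∃ (T' : V) (π : T' ⟶ T) (_ : Epi π) (x : T' ⟶ X), π ≫ y = x ≫ f := by
  obtain ⟨w, hw⟩ := h
  exact hw.exact_up_to_refinements y hy

lemma exactPair_of_up_to_refinements {X Y Z : V} {f : X ⟶ Y} {g : Y ⟶ Z} (w : f ≫ g = 0)
    (h : ∀ ⦃T : V⦄ (y : T ⟶ Y), y ≫ g = 0 →
      ∃ (T' : V) (π : T' ⟶ T) (_ : Epi π) (x : T' ⟶ X), π ≫ y = x ≫ f) : ExactPair f g :=
  ⟨w, (ShortComplex.exact_iff_exact_up_to_refinements _).2 h⟩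

variable {J : Type u'} [Category.{v'} J]

/-- Evaluation functors preserve homology, and a functor is zero once all its values are. -/
lemma shortComplex_exact_of_evaluation (S : ShortComplex (J ⥤ V))
    (h : ∀ j, (S.map ((evaluation J V).obj j)).Exact) : S.Exact := by
  rw [ShortComplex.exact_iff_isZero_homology, Functor.isZero_iff]
  intro j
  exact IsZero.of_iso ((ShortComplex.exact_iff_isZero_homology _).1 (h j))
    (S.mapHomologyIso ((evaluation J V).obj j)).symm

lemma exactPair_of_app {X Y Z : J ⥤ V} {f : X ⟶ Y} {g : Y ⟶ Z}
    (h : ∀ j, ExactPair (f.app j) (g.app j)) : ExactPair f g :=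
  ⟨by ext j; exact (h j).1, shortComplex_exact_of_evaluation _ fun j => (h j).2⟩

lemma ExactPair.app {X Y Z : J ⥤ V} {f : X ⟶ Y} {g : Y ⟶ Z} (h : ExactPair f g) (j : J) :
    ExactPair (f.app j) (g.app j) :=
  ⟨congr_app h.1 j, h.2.map ((evaluation J V).obj j)⟩

lemma exactPair_iso_comp {X X' Y Z : V} {f : X ⟶ Y} {g : Y ⟶ Z} (h : ExactPair f g)
    (e : X' ≅ X) : ExactPair (e.hom ≫ f) g :=
  exactPair_of_up_to_refinements (by rw [Category.assoc, h.1, comp_zero]) fun _ y hy => by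
    obtain ⟨T', π, hπ, x, hx⟩ := h.up_to_refinements y hy
    exact ⟨T', π, hπ, x ≫ e.inv, by simpa using hx⟩

lemma exactPair_comp_iso {X Y Z Z' : V} {f : X ⟶ Y} {g : Y ⟶ Z} (h : ExactPair f g)
    (e : Z ≅ Z') : ExactPair f (g ≫ e.hom) :=
  exactPair_of_up_to_refinements (by rw [← Category.assoc, h.1, zero_comp]) fun _ y hy =>
    h.up_to_refinements y ((cancel_mono e.hom).1 (by simpa using hy))

lemma exactPair_conj_iso {X Y Y' Z : V} {f : X ⟶ Y} {g : Y ⟶ Z} (h : ExactPair f g)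
    (e : Y' ≅ Y) : ExactPair (f ≫ e.inv) (e.hom ≫ g) :=
  exactPair_of_up_to_refinements (by simp [h.1]) fun _ y hy => by
    obtain ⟨T', π, hπ, x, hx⟩ := h.up_to_refinements (y ≫ e.hom) (by simpa using hy)
    exact ⟨T', π, hπ, x, by rw [← Category.assoc, ← hx]; simp⟩

namespace LongSequence

lemma IsComplex.replaceL {E : LongSequence V} (h : E.IsComplex) (L' : ℕ → V)
    (e : ∀ i, L' i ≅ E.L i) : (E.replaceL L' e).IsComplex := fun i => by
  obtain ⟨h1, h2, h3⟩ := h i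
  refine ⟨?_, ?_, ?_⟩
  · change (E.a i ≫ (e i).inv) ≫ (e i).hom ≫ E.l i = 0
    rw [Category.assoc, Iso.inv_hom_id_assoc, h1]
  · change ((e i).hom ≫ E.l i) ≫ E.s i = 0
    rw [Category.assoc, h2, comp_zero]
  · change E.s (i + 1) ≫ E.a i ≫ (e i).inv = 0
    rw [← Category.assoc, h3, zero_comp]

lemma ExactOffL.replaceL {E : LongSequence V} (h : E.ExactOffL) (L' : ℕ → V)
    (e : ∀ i, L' i ≅ E.L i) : (E.replaceL L' e).ExactOffL :=
  ⟨fun i => exactPair_iso_comp (h.1 i) (e i),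
    fun i => exactPair_comp_iso (h.2.1 i) (e i).symm, h.2.2⟩

lemma IsExact.replaceL {E : LongSequence V} (h : E.IsExact) (L' : ℕ → V)
    (e : ∀ i, L' i ≅ E.L i) : (E.replaceL L' e).IsExact :=
  ⟨h.1.replaceL L' e, fun i => exactPair_conj_iso (h.2 i) (e i)⟩

end LongSequence

end Pointwise

/-! ### Quot-stabilization as a cokernel, syzygy sequences, and chases in homology. -/

section LeftFundamentalSequence

variable {A : Type u} [Category.{v} A] [Abelian A] [HasProjectiveResolutions A]
  {D : Type u'} [Category.{v'} D] [Abelian D] (F : A ⥤ D) [F.Additive]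

lemma exactPair_fromLeftDerivedZero_quotStabπ :
    ExactPair F.fromLeftDerivedZero (quotStabπ F) :=
  exactPair_of_app fun X => ⟨cokernel.condition _,
    ShortComplex.exact_of_g_is_cokernel _ (cokernelIsCokernel (F.fromLeftDerivedZero.app X))⟩

instance : Epi (quotStabπ F) := NatTrans.epi_of_epi_app _

lemma quotStabπ_desc {X : A} {T : D} (k : F.obj X ⟶ T) (hk : F.fromLeftDerivedZero.app X ≫ k = 0) :
    ∃ k' : (quotStab F).obj X ⟶ T, (quotStabπ F).app X ≫ k' = k :=
  ⟨cokernel.desc _ k hk, cokernel.π_desc _ _ _⟩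

/-- The quot-stabilization of `F` at `X` is the cokernel of `F P ⟶ F X` for an epimorphism
`P ⟶ X` with `P` projective. -/
lemma exactPair_map_quotStabπ {P X : A} [Projective P] (p : P ⟶ X) [Epi p] :
    ExactPair (F.map p) ((quotStabπ F).app X) := by
  refine exactPair_of_up_to_refinements (map_quotStabπ F p) fun T y hy => ?_
  -- The projection of `F X` onto the cokernel of `F p` kills the image of `L_0 F`, so it factors
  -- through the quot-stabilization. An element dying there thus dies in the cokernel of `F p` and
  -- comes from `F P`.
  obtain ⟨k, hk⟩ := quotStabπ_desc F _
    (fromLeftDerivedZero_comp_eq_zero F p _ (cokernel.condition (F.map p)))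
  exact (ShortComplex.exact_of_g_is_cokernel (ShortComplex.mk _ _ (cokernel.condition (F.map p)))
    (cokernelIsCokernel (F.map p))).exact_up_to_refinements y
      (by
        change y ≫ cokernel.π (F.map p) = 0
        rw [← hk, ← Category.assoc, hy, zero_comp])

variable (R : ∀ B : A, ProjectiveResolution B)

lemma exactPair_syzι_π_zero (B : A) :
    ExactPair (syzι (R B).complex 0) ((R B).π.f 0) := by
  have h := (R B).exact₀
  refine exactPair_of_up_to_refinements ?_ fun T y hy => ?_
  · rw [← cancel_epi (syzπ (R B).complex 0), ← Category.assoc, syzπ_ι, comp_zero]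
    exact (R B).complex_d_comp_π_f_zero
  · obtain ⟨T', π, hπ, x, hx⟩ := h.exact_up_to_refinements y hy
    exact ⟨T', π, hπ, x ≫ syzπ _ 0, by rw [Category.assoc, syzπ_ι]; exact hx⟩

lemma exactPair_syzι_syzπ (B : A) (i : ℕ) :
    ExactPair (syzι (R B).complex (i + 1)) (syzπ (R B).complex i) := by
  have h := (R B).exact_succ i
  refine exactPair_of_up_to_refinements ?_ fun T y hy => ?_
  · rw [← cancel_mono (syzι (R B).complex i), Category.assoc, syzπ_ι, zero_comp, syzι_d]
  · obtain ⟨T', π, hπ, x, hx⟩ := h.exact_up_to_refinements y (by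
      change y ≫ (R B).complex.d (i + 1) i = 0
      rw [← syzπ_ι, ← Category.assoc, hy, zero_comp])
    exact ⟨T', π, hπ, x ≫ syzπ _ (i + 1), by rw [Category.assoc, syzπ_ι]; exact hx⟩

/-- Applied below to the syzygy sequences. -/
lemma HalfExact.exactPair_map {F : A ⥤ D} [F.Additive] (hF : HalfExact F) {X Y Z : A} {f : X ⟶ Y}
    {g : Y ⟶ Z} [Mono f] [Epi g] (h : ExactPair f g) : ExactPair (F.map f) (F.map g) :=
  ⟨by rw [← F.map_comp, h.1, F.map_zero], hF _ { exact := h.2 }⟩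

/-- If `l` is induced on homology by `q`, and `m` is the kernel part of `q`, then the sequence
`Y ⟶ H_i K ⟶ Z` is exact. -/
lemma exactPair_cycleToHomology (K : ChainComplex D ℕ) (i : ℕ) {Y Z : D} (m : Y ⟶ K.X i)
    (q : K.X i ⟶ Z) (hmq : ExactPair m q)
    (hm : m ≫ K.d i ((ComplexShape.down ℕ).next i) = 0)
    (l : K.homology i ⟶ Z)
    (hl : ∀ ⦃T : D⦄ (z : T ⟶ K.X i) (hz : z ≫ K.d i ((ComplexShape.down ℕ).next i) = 0),
      K.liftCycles z _ rfl hz ≫ K.homologyπ i ≫ l = z ≫ q) :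
    ExactPair (cycleToHomology K i m hm) l := by
  refine exactPair_of_up_to_refinements ?_ fun T y hy => ?_
  · rw [cycleToHomology, Category.assoc, hl, hmq.1]
  -- A class is represented by a cycle `z`; by `hl`, dying under `l` means `z ≫ q = 0`, so `z`
  -- itself comes from `Y`.
  · obtain ⟨T₁, π₁, hπ₁, z, hz, h₁⟩ := K.eq_liftCycles_homologyπ_up_to_refinements y _ rfl
    obtain ⟨T₂, π₂, hπ₂, x, h₂⟩ := hmq.up_to_refinements z (by
      rw [← hl z hz, ← Category.assoc, ← h₁, Category.assoc, hy, comp_zero])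
    refine ⟨T₂, π₂ ≫ π₁, inferInstance, x, ?_⟩
    rw [Category.assoc, h₁, cycleToHomology, ← Category.assoc, ← Category.assoc,
      K.comp_liftCycles, K.comp_liftCycles]
    simp only [h₂]

lemma exactPair_of_epi_comp {W X Y Z : D} {e : W ⟶ X} [Epi e] {f : X ⟶ Y} {g : Y ⟶ Z}
    (h : ExactPair (e ≫ f) g) : ExactPair f g :=
  exactPair_of_up_to_refinements (by rw [← cancel_epi e, ← Category.assoc, h.1, comp_zero])
    fun _ y hy => by
      obtain ⟨T', π, hπ, x, hx⟩ := h.up_to_refinements y hy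
      exact ⟨T', π, hπ, x ≫ e, by rw [hx, Category.assoc]⟩

lemma isoLeftDerivedObj_inv_derivedToSatellite (i : ℕ) (B : A) :
    ((R B).isoLeftDerivedObj F (i + 1)).inv ≫ (derivedToSatellite F R i).app B =
      homologyToKernel (mapRes F R B) i (F.map (syzπ (R B).complex i))
        (F.map (syzι (R B).complex i)) (map_d_syzπ F R i B) (map_syzπ_ι F R i B) :=
  Iso.inv_hom_id_assoc _ _

lemma liftCycles_homologyToKernel_ι (K : ChainComplex D ℕ) (i : ℕ) {Y : D} (e : K.X (i + 1) ⟶ Y)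
    (m : Y ⟶ K.X i) (he : K.d (i + 2) (i + 1) ≫ e = 0) (hm : e ≫ m = K.d (i + 1) i) {T : D}
    (z : T ⟶ K.X (i + 1)) (j : ℕ) (hj : (ComplexShape.down ℕ).next (i + 1) = j)
    (hz : z ≫ K.d (i + 1) j = 0) :
    (K.liftCycles z j hj hz ≫ K.homologyπ (i + 1)) ≫ homologyToKernel K i e m he hm ≫ kernel.ι m =
      z ≫ e := by
  rw [Category.assoc, homologyπ_homologyToKernel_ι, ← Category.assoc, K.liftCycles_i]

/-- An element of `ker m` killed by `p` lifts along `e`. The lift is a cycle because the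
differential is `e ≫ m`, and its homology class is the required preimage. This yields exactness at
the satellites. -/
lemma exactPair_homologyToKernel (K : ChainComplex D ℕ) (i : ℕ) {Y Z : D} (e : K.X (i + 1) ⟶ Y)
    (m : Y ⟶ K.X i) (he : K.d (i + 2) (i + 1) ≫ e = 0) (hm : e ≫ m = K.d (i + 1) i)
    (p : Y ⟶ Z) (hp : ExactPair e p) :
    ExactPair (homologyToKernel K i e m he hm) (kernel.ι m ≫ p) := by
  refine exactPair_of_up_to_refinements ?_ fun T y hy => ?_
  · rw [← cancel_epi (K.homologyπ (i + 1)), ← Category.assoc (homologyToKernel K i e m he hm),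
      ← Category.assoc, homologyπ_homologyToKernel_ι, Category.assoc, hp.1, comp_zero, comp_zero]
  · obtain ⟨T', π, hπ, x, hx⟩ := hp.up_to_refinements (y ≫ kernel.ι m) (by simpa using hy)
    have hz : x ≫ K.d (i + 1) i = 0 := by
      rw [← hm, ← Category.assoc, ← hx, Category.assoc, Category.assoc, kernel.condition,
        comp_zero, comp_zero]
    refine ⟨T', π, hπ, K.liftCycles x i (by simp) hz ≫ K.homologyπ (i + 1), ?_⟩
    rw [← cancel_mono (kernel.ι m), Category.assoc, Category.assoc (_ ≫ _), hx]
    exact (liftCycles_homologyToKernel_ι K i e m he hm x i (by simp) hz).symm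

end LeftFundamentalSequence

/-! ### Exactness at the quot-stabilizations and at the derived functors, for a general complex. -/

section CyclesAndHomology

variable {D : Type u'} [Category.{v'} D] [Abelian D]

lemma cycleToHomology_eq_zero_up_to_refinements (K : ChainComplex D ℕ) (i : ℕ) {Y : D}
    (m : Y ⟶ K.X i) (hm : m ≫ K.d i ((ComplexShape.down ℕ).next i) = 0) {T : D} (y : T ⟶ Y)
    (hy : y ≫ cycleToHomology K i m hm = 0) :
    ∃ (T' : D) (π : T' ⟶ T) (_ : Epi π) (x : T' ⟶ K.X (i + 1)),
      π ≫ y ≫ m = x ≫ K.d (i + 1) i := by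
  rw [cycleToHomology, ← Category.assoc, K.comp_liftCycles] at hy
  exact (K.liftCycles_comp_homologyπ_eq_zero_iff_up_to_refinements (i + 1) i _ (by simp) rfl
    _ _).1 hy

/-- If `U` is the cokernel of `e : K (i+1) ⟶ Y`, then `ker m ⟶ U ⟶ H_i K` is exact. -/
lemma exactPair_kernel_ι_comp (K : ChainComplex D ℕ) (i : ℕ) {Y U : D} (e : K.X (i + 1) ⟶ Y)
    (m : Y ⟶ K.X i) (hem : e ≫ m = K.d (i + 1) i)
    (hm : m ≫ K.d i ((ComplexShape.down ℕ).next i) = 0) (p : Y ⟶ U) [Epi p] (hep : e ≫ p = 0)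
    (a : U ⟶ K.homology i) (ha : p ≫ a = cycleToHomology K i m hm) :
    ExactPair (kernel.ι m ≫ p) a := by
  refine exactPair_of_up_to_refinements ?_ fun T y hy => ?_
  · rw [Category.assoc, ha, ← cancel_mono (K.homologyι i), Category.assoc, cycleToHomology_ι,
      kernel.condition_assoc, zero_comp, zero_comp]
  · obtain ⟨T₁, π₁, hπ₁, x, hx⟩ := surjective_up_to_refinements_of_epi p y
    obtain ⟨T₂, π₂, hπ₂, w, hw⟩ := cycleToHomology_eq_zero_up_to_refinements K i m hm x
      (by rw [← ha, ← Category.assoc, ← hx, Category.assoc, hy, comp_zero])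
    -- Since `m` sends `x` to the boundary of `w`, subtracting `w ≫ e` moves `x` into `ker m`
    -- without changing its image in `U`, because `e ≫ p = 0`.
    have hk : (π₂ ≫ x - w ≫ e) ≫ m = 0 := by
      rw [Preadditive.sub_comp, Category.assoc, Category.assoc, hem, ← hw, sub_self]
    refine ⟨T₂, π₂ ≫ π₁, inferInstance, kernel.lift _ _ hk, ?_⟩
    rw [kernel.lift_ι_assoc, Preadditive.sub_comp, Category.assoc w, hep, comp_zero, sub_zero,
      Category.assoc, Category.assoc, hx]

lemma exactPair_of_comp_mono {X Y Z Z' : D} {f : X ⟶ Y} {g : Y ⟶ Z} {j : Z ⟶ Z'} [Mono j]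
    (h : ExactPair f (g ≫ j)) : ExactPair f g :=
  exactPair_of_up_to_refinements
    (by rw [← cancel_mono j, Category.assoc, h.1, zero_comp]) fun _ y hy =>
      h.up_to_refinements y (by rw [← Category.assoc, hy, zero_comp])

lemma cycleToHomology_homologyToKernel_ι (K : ChainComplex D ℕ) (i : ℕ) {W Y : D}
    (e : K.X (i + 1) ⟶ Y) (m : Y ⟶ K.X i) (he : K.d (i + 2) (i + 1) ≫ e = 0)
    (hem : e ≫ m = K.d (i + 1) i) (m' : W ⟶ K.X (i + 1))
    (hm' : m' ≫ K.d (i + 1) ((ComplexShape.down ℕ).next (i + 1)) = 0) :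
    cycleToHomology K (i + 1) m' hm' ≫ homologyToKernel K i e m he hem ≫ kernel.ι m = m' ≫ e := by
  rw [cycleToHomology, liftCycles_homologyToKernel_ι]

/-- Neither precomposing with the epimorphism `p` nor postcomposing with the kernel inclusion
affects exactness, so the claim reduces to `exactPair_cycleToHomology`. -/
lemma exactPair_homologyToKernel_of_exactPair (K : ChainComplex D ℕ) (i : ℕ) {W Y U : D}
    (e : K.X (i + 1) ⟶ Y) (m : Y ⟶ K.X i) (he : K.d (i + 2) (i + 1) ≫ e = 0)
    (hem : e ≫ m = K.d (i + 1) i) (m' : W ⟶ K.X (i + 1))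
    (hm' : m' ≫ K.d (i + 1) ((ComplexShape.down ℕ).next (i + 1)) = 0) (p : W ⟶ U) [Epi p]
    (a : U ⟶ K.homology (i + 1)) (ha : p ≫ a = cycleToHomology K (i + 1) m' hm')
    (h : ExactPair m' e) : ExactPair a (homologyToKernel K i e m he hem) := by
  refine exactPair_of_epi_comp (e := p) (exactPair_of_comp_mono (j := kernel.ι m) ?_)
  rw [ha]
  exact exactPair_cycleToHomology K (i + 1) m' e h hm' _ fun T z hz => by
    rw [← Category.assoc, liftCycles_homologyToKernel_ι]

/-- Only `m' ≫ e = 0` is needed here, not exactness; hence the fundamental sequence is a complex for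
every additive functor. -/
lemma comp_homologyToKernel_eq_zero (K : ChainComplex D ℕ) (i : ℕ) {W Y U : D}
    (e : K.X (i + 1) ⟶ Y) (m : Y ⟶ K.X i) (he : K.d (i + 2) (i + 1) ≫ e = 0)
    (hem : e ≫ m = K.d (i + 1) i) (m' : W ⟶ K.X (i + 1))
    (hm' : m' ≫ K.d (i + 1) ((ComplexShape.down ℕ).next (i + 1)) = 0) (p : W ⟶ U) [Epi p]
    (a : U ⟶ K.homology (i + 1)) (ha : p ≫ a = cycleToHomology K (i + 1) m' hm')
    (h : m' ≫ e = 0) : a ≫ homologyToKernel K i e m he hem = 0 := by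
  rw [← cancel_epi p, ← cancel_mono (kernel.ι m), ← Category.assoc p, ha, Category.assoc,
    cycleToHomology_homologyToKernel_ι, h, comp_zero, zero_comp]

lemma comp_eq_zero_of_cycleToHomology (K : ChainComplex D ℕ) (i : ℕ) {Y U Z : D} (m : Y ⟶ K.X i)
    (q : K.X i ⟶ Z) (hmq : m ≫ q = 0)
    (hm : m ≫ K.d i ((ComplexShape.down ℕ).next i) = 0) (p : Y ⟶ U) [Epi p]
    (a : U ⟶ K.homology i) (l : K.homology i ⟶ Z) (ha : p ≫ a = cycleToHomology K i m hm)
    (hl : ∀ ⦃T : D⦄ (z : T ⟶ K.X i) (hz : z ≫ K.d i ((ComplexShape.down ℕ).next i) = 0),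
      K.liftCycles z _ rfl hz ≫ K.homologyπ i ≫ l = z ≫ q) : a ≫ l = 0 := by
  rw [← cancel_epi p, ← Category.assoc, ha, cycleToHomology, Category.assoc, hl, hmq, comp_zero]

end CyclesAndHomology

/-! ### The left fundamental sequence of an additive functor. -/

section LeftFundamentalSequence

variable {A : Type u} [Category.{v} A] [Abelian A] [HasProjectiveResolutions A]
  {D : Type u'} [Category.{v'} D] [Abelian D] (F : A ⥤ D) [F.Additive]

variable (R : ∀ B : A, ProjectiveResolution B)

instance (B : A) (i : ℕ) : Projective ((R B).complex.X i) := (R B).projective i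

lemma exactPair_derivedToSatellite_app (i : ℕ) (B : A) :
    ExactPair ((derivedToSatellite F R i).app B) ((satelliteToQuotStab F R i).app B) :=
  exactPair_iso_comp (exactPair_homologyToKernel (mapRes F R B) i _ _ (map_d_syzπ F R i B)
    (map_syzπ_ι F R i B) _ (exactPair_map_quotStabπ F (syzπ (R B).complex i)))
    ((R B).isoLeftDerivedObj F (i + 1))

/-- The map induced by `F (Ω^(i+1) B) ⟶ F (P i)` on the quot-stabilization of `F`. -/
def quotStabToHomology (i : ℕ) (B : A) :
    (quotStab F).obj (syz (R B).complex i) ⟶ (mapRes F R B).homology i :=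
  cokernel.desc (F.fromLeftDerivedZero.app (syz (R B).complex i))
    (cycleToHomology (mapRes F R B) i (F.map (syzι (R B).complex i)) (map_syzι_d F R i _ B))
    (fromLeftDerivedZero_comp_eq_zero F (syzπ (R B).complex i) _
      (comp_cycleToHomology (mapRes F R B) i (F.map (syzπ (R B).complex i))
        (F.map (syzι (R B).complex i)) _ (map_syzπ_ι F R i B)))

lemma quotStabπ_quotStabToHomology (i : ℕ) (B : A) :
    (quotStabπ F).app (syz (R B).complex i) ≫ quotStabToHomology F R i B =
      cycleToHomology (mapRes F R B) i (F.map (syzι (R B).complex i)) (map_syzι_d F R i _ B) :=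
  cokernel.π_desc _ _ _

lemma quotStabToDerived_app (i : ℕ) (B : A) : (quotStabToDerived F R i).app B =
    quotStabToHomology F R i B ≫ ((R B).isoLeftDerivedObj F i).inv := rfl

lemma exactPair_satelliteToQuotStab_app (i : ℕ) (B : A) :
    ExactPair ((satelliteToQuotStab F R i).app B) ((quotStabToDerived F R i).app B) :=
  exactPair_comp_iso (exactPair_kernel_ι_comp (mapRes F R B) i _ _ (map_syzπ_ι F R i B)
    (map_syzι_d F R i _ B) _ (map_quotStabπ F (syzπ (R B).complex i)) _
    (quotStabπ_quotStabToHomology F R i B)) ((R B).isoLeftDerivedObj F i).symm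

lemma quotStabToDerived_comp_derivedToSatellite (i : ℕ) (B : A) :
    (quotStabToDerived F R (i + 1)).app B ≫ (derivedToSatellite F R i).app B = 0 := by
  have h := comp_homologyToKernel_eq_zero (mapRes F R B) i (F.map (syzπ (R B).complex i))
    (F.map (syzι (R B).complex i)) (map_d_syzπ F R i B) (map_syzπ_ι F R i B)
    (F.map (syzι (R B).complex (i + 1))) (map_syzι_d F R (i + 1) _ B) _ _
    (quotStabπ_quotStabToHomology F R (i + 1) B)
    ((F.map_comp _ _).symm.trans ((congrArg F.map (exactPair_syzι_syzπ R B i).1).trans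
      (F.map_zero _ _)))
  refine (Category.assoc _ _ _).trans (Eq.trans ?_ h)
  exact congrArg (_ ≫ ·) (isoLeftDerivedObj_inv_derivedToSatellite F R i B)

/-- Half-exactness is applied to `0 ⟶ Ω^(i+2) B ⟶ P_(i+1) ⟶ Ω^(i+1) B ⟶ 0`. -/
lemma exactPair_quotStabToDerived_succ_app (hF : HalfExact F) (i : ℕ) (B : A) :
    ExactPair ((quotStabToDerived F R (i + 1)).app B) ((derivedToSatellite F R i).app B) :=
  exactPair_conj_iso (exactPair_homologyToKernel_of_exactPair (mapRes F R B) i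
    (F.map (syzπ (R B).complex i)) (F.map (syzι (R B).complex i)) (map_d_syzπ F R i B)
    (map_syzπ_ι F R i B) (F.map (syzι (R B).complex (i + 1))) (map_syzι_d F R (i + 1) _ B) _ _
    (quotStabπ_quotStabToHomology F R (i + 1) B)
    (hF.exactPair_map (exactPair_syzι_syzπ R B i))) ((R B).isoLeftDerivedObj F (i + 1))

/-- In degree zero the augmentation `P_0 ⟶ B` takes the place of `e`; this supplies the hypothesis
`hl` of the homology chases. -/
lemma cycleToHomology_fromLeftDerivedZero {B : A} {T : D} (z : T ⟶ (mapRes F R B).X 0)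
    (hz : z ≫ (mapRes F R B).d 0 ((ComplexShape.down ℕ).next 0) = 0) :
    (mapRes F R B).liftCycles z _ rfl hz ≫ (mapRes F R B).homologyπ 0 ≫
      (mapRes F R B).homologyι 0 ≫ (R B).fromLeftDerivedZero' F = z ≫ F.map ((R B).π.f 0) := by
  have h : (mapRes F R B).pOpcycles 0 ≫ (R B).fromLeftDerivedZero' F = F.map ((R B).π.f 0) :=
    (R B).pOpcycles_comp_fromLeftDerivedZero' F
  rw [HomologicalComplex.homology_π_ι_assoc, HomologicalComplex.liftCycles_i_assoc]
  exact congrArg (z ≫ ·) h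

lemma fromLeftDerivedZero_app_eq (B : A) : F.fromLeftDerivedZero.app B =
    ((R B).isoLeftDerivedObj F 0).hom ≫
      (mapRes F R B).homologyι 0 ≫ (R B).fromLeftDerivedZero' F :=
  (R B).fromLeftDerivedZero_eq F

lemma quotStabToDerived_comp_fromLeftDerivedZero (B : A) :
    (quotStabToDerived F R 0).app B ≫ F.fromLeftDerivedZero.app B = 0 := by
  have h : quotStabToHomology F R 0 B ≫
      (mapRes F R B).homologyι 0 ≫ (R B).fromLeftDerivedZero' F = 0 := by
    refine comp_eq_zero_of_cycleToHomology (mapRes F R B) 0 _ (F.map ((R B).π.f 0)) ?_ _ _ _ _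
      (quotStabπ_quotStabToHomology F R 0 B)
      fun T z hz => cycleToHomology_fromLeftDerivedZero F R z hz
    exact (F.map_comp _ _).symm.trans ((congrArg F.map (exactPair_syzι_π_zero R B).1).trans
      (F.map_zero _ _))
  rw [fromLeftDerivedZero_app_eq F R B, quotStabToDerived_app]
  refine (Category.assoc _ _ _).trans (Eq.trans ?_ h)
  exact congrArg (_ ≫ ·) (Iso.inv_hom_id_assoc _ _)

lemma exactPair_quotStabToDerived_zero_app (hF : HalfExact F) (B : A) :
    ExactPair ((quotStabToDerived F R 0).app B) (F.fromLeftDerivedZero.app B) := by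
  have h : ExactPair (quotStabToHomology F R 0 B)
      ((mapRes F R B).homologyι 0 ≫ (R B).fromLeftDerivedZero' F) := by
    refine exactPair_of_epi_comp (e := (quotStabπ F).app (syz (R B).complex 0)) ?_
    rw [quotStabπ_quotStabToHomology]
    exact exactPair_cycleToHomology (mapRes F R B) 0 _ (F.map ((R B).π.f 0))
      (hF.exactPair_map (exactPair_syzι_π_zero R B)) _ _
      fun T z hz => cycleToHomology_fromLeftDerivedZero F R z hz
  rw [fromLeftDerivedZero_app_eq F R B]
  exact exactPair_conj_iso h ((R B).isoLeftDerivedObj F 0)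

theorem leftFundamentalSequence_exactOffL : (leftFundamentalSequence F R).ExactOffL := by
  refine ⟨fun i => ?_, fun i => exactPair_of_app (exactPair_satelliteToQuotStab_app F R i), ?_⟩
  · cases i with
    | zero => exact exactPair_fromLeftDerivedZero_quotStabπ F
    | succ i => exact exactPair_of_app (exactPair_derivedToSatellite_app F R i)
  · exact (inferInstance : Epi (quotStabπ F))

theorem leftFundamentalSequence_isComplex : (leftFundamentalSequence F R).IsComplex := by
  refine fun i => ⟨?_, ((leftFundamentalSequence_exactOffL F R).1 i).1,
    ((leftFundamentalSequence_exactOffL F R).2.1 i).1⟩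
  cases i with
  | zero => exact NatTrans.ext (funext (quotStabToDerived_comp_fromLeftDerivedZero F R))
  | succ i => exact NatTrans.ext (funext (quotStabToDerived_comp_derivedToSatellite F R i))

theorem leftFundamentalSequence_isExact (hF : HalfExact F) :
    (leftFundamentalSequence F R).IsExact := by
  refine ⟨leftFundamentalSequence_exactOffL F R, fun i => ?_⟩
  cases i with
  | zero => exact exactPair_of_app (exactPair_quotStabToDerived_zero_app F R hF)
  | succ i => exact exactPair_of_app (exactPair_quotStabToDerived_succ_app F R hF i)

end LeftFundamentalSequence

/-! ### Right exactness of the tensor product over `Λ`, deduced from the case of `ℤ`. -/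

section Tensor

open scoped TensorProduct MulOpposite

variable {Λ : Type u} [Ring Λ]

/-- The map `f ⊗ g` on tensor products over `ℤ`. -/
abbrev intTensMap {M M' : ModuleCat.{u} Λᵐᵒᵖ} {X X' : ModuleCat.{u} Λ} (f : M ⟶ M') (g : X ⟶ X') :
    M ⊗[ℤ] X →ₗ[ℤ] M' ⊗[ℤ] X' :=
  TensorProduct.map f.hom.toAddMonoidHom.toIntLinearMap g.hom.toAddMonoidHom.toIntLinearMap

lemma tensMap_mk {M M' : ModuleCat.{u} Λᵐᵒᵖ} {X X' : ModuleCat.{u} Λ} (f : M ⟶ M') (g : X ⟶ X')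
    (t : M ⊗[ℤ] X) : tensMap f g (QuotientAddGroup.mk t) = QuotientAddGroup.mk (intTensMap f g t) :=
  rfl

/-- A generating relation is lifted by choosing preimages of `m` and `x`, as `f` and `g` are linear
over the ring. This is what lets exactness over `ℤ` descend to `Λ`. -/
lemma exists_mem_balancedRelations {M M' : ModuleCat.{u} Λᵐᵒᵖ} {X X' : ModuleCat.{u} Λ}
    (f : M ⟶ M') (g : X ⟶ X') (hf : Function.Surjective f.hom) (hg : Function.Surjective g.hom)
    {t : M' ⊗[ℤ] X'} (ht : t ∈ balancedRelations M' X') :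
    ∃ s ∈ balancedRelations M X, intTensMap f g s = t := by
  induction ht using AddSubgroup.closure_induction with
  | mem t ht =>
    obtain ⟨m, a, x, rfl⟩ := ht
    obtain ⟨m, rfl⟩ := hf m
    obtain ⟨x, rfl⟩ := hg x
    exact ⟨_, AddSubgroup.subset_closure ⟨m, a, x, rfl⟩,
      (map_sub (intTensMap f g) _ _).trans (congrArg₂ (· - ·)
        (congrArg (· ⊗ₜ[ℤ] g.hom x) (f.hom.map_smul _ m))
        (congrArg (f.hom m ⊗ₜ[ℤ] ·) (g.hom.map_smul a x)))⟩
  | zero => exact ⟨0, zero_mem _, map_zero _⟩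
  | add x y _ _ hx hy =>
    obtain ⟨s, hs, rfl⟩ := hx
    obtain ⟨t, ht, rfl⟩ := hy
    exact ⟨s + t, add_mem hs ht, map_add _ _ _⟩
  | neg x _ hx =>
    obtain ⟨s, hs, rfl⟩ := hx
    exact ⟨-s, neg_mem hs, map_neg _ _⟩

lemma tensMap_surjective {M M' : ModuleCat.{u} Λᵐᵒᵖ} {X X' : ModuleCat.{u} Λ}
    (f : M ⟶ M') (g : X ⟶ X') (hf : Function.Surjective f.hom) (hg : Function.Surjective g.hom) :
    Function.Surjective (tensMap f g) := fun q => by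
  obtain ⟨t, rfl⟩ := QuotientAddGroup.mk_surjective q
  obtain ⟨s, hs⟩ := TensorProduct.map_surjective (R := ℤ)
    (g := f.hom.toAddMonoidHom.toIntLinearMap) (g' := g.hom.toAddMonoidHom.toIntLinearMap) hf hg t
  exact ⟨QuotientAddGroup.mk s, congrArg QuotientAddGroup.mk hs⟩

/-- Exactness of a sequence of tensor products over `Λ` follows from exactness over `ℤ`. -/
lemma tensMap_exact {M M' M'' : ModuleCat.{u} Λᵐᵒᵖ} {X X' X'' : ModuleCat.{u} Λ}
    (f : M ⟶ M') (g : X ⟶ X') (f' : M' ⟶ M'') (g' : X' ⟶ X'')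
    (hf : Function.Surjective f'.hom) (hg : Function.Surjective g'.hom)
    (h : Function.Exact (intTensMap f g) (intTensMap f' g')) (q : Tens M' X')
    (hq : tensMap f' g' q = 0) : ∃ p, tensMap f g p = q := by
  obtain ⟨t, rfl⟩ := QuotientAddGroup.mk_surjective q
  rw [tensMap_mk, QuotientAddGroup.eq_zero_iff] at hq
  -- Subtracting the relation `s` leaves the class of `t` unchanged and puts `t - s` in the kernel
  -- over `ℤ`.
  obtain ⟨s, hs, hst⟩ := exists_mem_balancedRelations f' g' hf hg hq
  obtain ⟨r, hr⟩ := (h (t - s)).1 (by rw [map_sub, hst, sub_self])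
  refine ⟨QuotientAddGroup.mk r, ?_⟩
  rw [tensMap_mk, hr, QuotientAddGroup.mk_sub, (QuotientAddGroup.eq_zero_iff s).2 hs, sub_zero]

lemma exact_map_tensorFunctor_obj (M : ModuleCat.{u} Λᵐᵒᵖ) (S : ShortComplex (ModuleCat.{u} Λ))
    (hS : S.Exact) [Epi S.g] : (S.map ((tensorFunctor Λ).obj M)).Exact := by
  have hg : Function.Surjective S.g.hom := (ModuleCat.epi_iff_surjective _).1 inferInstance
  refine (ShortComplex.ab_exact_iff _).2 fun q hq => ?_
  refine tensMap_exact (𝟙 M) S.f (𝟙 M) S.g (fun m => ⟨m, rfl⟩) hg ?_ q hq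
  exact lTensor_exact M (f := S.f.hom.toAddMonoidHom.toIntLinearMap)
    (g := S.g.hom.toAddMonoidHom.toIntLinearMap)
    ((ShortComplex.ShortExact.moduleCat_exact_iff_function_exact S).1 hS) hg

lemma exact_map_tensorFunctor_flip_obj (X : ModuleCat.{u} Λ)
    (S : ShortComplex (ModuleCat.{u} Λᵐᵒᵖ))
    (hS : S.Exact) [Epi S.g] : (S.map ((tensorFunctor Λ).flip.obj X)).Exact := by
  have hg : Function.Surjective S.g.hom := (ModuleCat.epi_iff_surjective _).1 inferInstance
  refine (ShortComplex.ab_exact_iff _).2 fun q hq => ?_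
  refine tensMap_exact S.f (𝟙 X) S.g (𝟙 X) hg (fun m => ⟨m, rfl⟩) ?_ q hq
  exact rTensor_exact X (f := S.f.hom.toAddMonoidHom.toIntLinearMap)
    (g := S.g.hom.toAddMonoidHom.toIntLinearMap)
    ((ShortComplex.ShortExact.moduleCat_exact_iff_function_exact S).1 hS) hg

instance (M : ModuleCat.{u} Λᵐᵒᵖ) : PreservesFiniteColimits ((tensorFunctor Λ).obj M) :=
  (Functor.preservesFiniteColimits_iff_forall_exact_map_and_epi _).2 fun S hS => by
    have := hS.epi_g
    refine ⟨exact_map_tensorFunctor_obj M S hS.exact, (AddCommGrpCat.epi_iff_surjective _).2 ?_⟩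
    exact tensMap_surjective _ _ (fun m => ⟨m, rfl⟩) ((ModuleCat.epi_iff_surjective _).1 this)

instance (X : ModuleCat.{u} Λ) : PreservesFiniteColimits ((tensorFunctor Λ).flip.obj X) :=
  (Functor.preservesFiniteColimits_iff_forall_exact_map_and_epi _).2 fun S hS => by
    have := hS.epi_g
    refine ⟨exact_map_tensorFunctor_flip_obj X S hS.exact,
      (AddCommGrpCat.epi_iff_surjective _).2 ?_⟩
    exact tensMap_surjective _ _ ((ModuleCat.epi_iff_surjective _).1 this) (fun m => ⟨m, rfl⟩)

/-! ### Flatness of free and projective modules. -/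

lemma tmk_smul {M : ModuleCat.{u} Λᵐᵒᵖ} {X : ModuleCat.{u} Λ} (m : M) (a : Λ) (x : X) :
    tmk m (a • x) = tmk (MulOpposite.op a • m) x := by
  refine Eq.symm (sub_eq_zero.1 ?_)
  exact (QuotientAddGroup.eq_zero_iff _).2 (AddSubgroup.subset_closure ⟨m, a, x, rfl⟩)

/-- The map `M × Λ^(σ) ⟶ M^(σ)` that sends `(m, s)` to the family of the `m (s i)`. -/
def finsuppAct (M : ModuleCat.{u} Λᵐᵒᵖ) (σ : Type u) : M →+ (σ →₀ Λ) →+ (σ →₀ M) :=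
  (Finsupp.liftAddHom fun i : σ => AddMonoidHom.mk' (fun a : Λ => AddMonoidHom.mk'
    (fun m : M => Finsupp.single i (MulOpposite.op a • m)) (by simp))
    (fun a b => by ext m; simp [add_smul])).flip

lemma finsuppAct_single (M : ModuleCat.{u} Λᵐᵒᵖ) (σ : Type u) (m : M) (i : σ) (a : Λ) :
    finsuppAct M σ m (Finsupp.single i a) = Finsupp.single i (MulOpposite.op a • m) := by
  simp [finsuppAct]

lemma finsuppAct_smul (M : ModuleCat.{u} Λᵐᵒᵖ) (σ : Type u) (m : M) (a : Λ) (x : σ →₀ Λ) :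
    finsuppAct M σ (MulOpposite.op a • m) x = finsuppAct M σ m (a • x) := by
  induction x using Finsupp.induction_linear with
  | zero => simp
  | add x y hx hy => rw [map_add, hx, hy, smul_add, map_add]
  | single i b =>
    rw [Finsupp.smul_single, smul_eq_mul, finsuppAct_single, finsuppAct_single, MulOpposite.op_mul,
      mul_smul]

/-- The map `M ⊗ Λ^(σ) ⟶ M^(σ)`. -/
def tensFinsupp (M : ModuleCat.{u} Λᵐᵒᵖ) (σ : Type u) :
    Tens M (ModuleCat.of Λ (σ →₀ Λ)) →+ (σ →₀ M) :=
  QuotientAddGroup.lift _ (TensorProduct.liftAddHom (finsuppAct M σ)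
    (fun r m x => by
      rw [map_zsmul, map_zsmul]; rfl)) (by
    rw [balancedRelations, AddSubgroup.closure_le]
    rintro _ ⟨m, a, x, rfl⟩
    rw [SetLike.mem_coe, AddMonoidHom.mem_ker, map_sub, sub_eq_zero]
    exact finsuppAct_smul M σ m a x)

/-- The map `M^(σ) ⟶ M ⊗ Λ^(σ)`. -/
def finsuppTens (M : ModuleCat.{u} Λᵐᵒᵖ) (σ : Type u) :
    (σ →₀ M) →+ Tens M (ModuleCat.of Λ (σ →₀ Λ)) :=
  Finsupp.liftAddHom fun i => AddMonoidHom.mk'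
    (fun m => tmk (X := ModuleCat.of Λ (σ →₀ Λ)) m (Finsupp.single i (1 : Λ)))
    fun m m' => tmk_add_left m m' _

lemma finsuppTens_single (M : ModuleCat.{u} Λᵐᵒᵖ) (σ : Type u) (i : σ) (m : M) :
    finsuppTens M σ (Finsupp.single i m) =
      tmk (X := ModuleCat.of Λ (σ →₀ Λ)) m (Finsupp.single i (1 : Λ)) :=
  Finsupp.liftAddHom_apply_single _ _ _

/-- A left inverse is enough: only the injectivity of `tensFinsupp` is needed. -/
lemma finsuppTens_tensFinsupp (M : ModuleCat.{u} Λᵐᵒᵖ) (σ : Type u)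
    (q : Tens M (ModuleCat.of Λ (σ →₀ Λ))) : finsuppTens M σ (tensFinsupp M σ q) = q := by
  refine DFunLike.congr_fun (f := (finsuppTens M σ).comp (tensFinsupp M σ))
    (g := AddMonoidHom.id _) (tens_hom_ext fun m x => ?_) q
  change finsuppTens M σ (finsuppAct M σ m x) = tmk m x
  induction x using Finsupp.induction_linear with
  | zero =>
    rw [map_zero, map_zero]
    exact (congrArg QuotientAddGroup.mk (TensorProduct.tmul_zero _ m)).symm
  | add x y hx hy => rw [map_add, map_add, hx, hy]; exact (tmk_add_right (X := ModuleCat.of Λ (σ →₀ Λ)) m x y).symm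
  | single i a =>
    rw [finsuppAct_single, finsuppTens_single, ← tmk_smul]
    exact congrArg (tmk m) (by simp)

lemma tensFinsupp_naturality {M M' : ModuleCat.{u} Λᵐᵒᵖ} (f : M ⟶ M') (σ : Type u)
    (q : Tens M (ModuleCat.of Λ (σ →₀ Λ))) :
    tensFinsupp M' σ (tensMap f (𝟙 _) q) =
      Finsupp.mapRange.addMonoidHom f.hom.toAddMonoidHom (tensFinsupp M σ q) := by
  refine DFunLike.congr_fun (f := (tensFinsupp M' σ).comp (tensMap f (𝟙 _)))
    (g := (Finsupp.mapRange.addMonoidHom f.hom.toAddMonoidHom).comp (tensFinsupp M σ))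
    (tens_hom_ext fun m x => ?_) q
  change finsuppAct M' σ (f.hom m) x =
    Finsupp.mapRange.addMonoidHom f.hom.toAddMonoidHom (finsuppAct M σ m x)
  induction x using Finsupp.induction_linear with
  | zero => simp
  | add x y hx hy => rw [map_add, hx, hy, map_add, map_add]
  | single i a => simp [finsuppAct_single]

/-- Under `tensFinsupp` the map becomes `f` applied to each coordinate. -/
lemma tensMap_finsupp_injective {M M' : ModuleCat.{u} Λᵐᵒᵖ} (f : M ⟶ M')
    (hf : Function.Injective f.hom) (σ : Type u) :
    Function.Injective (tensMap f (𝟙 (ModuleCat.of Λ (σ →₀ Λ)))) := by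
  have h : Function.Injective (Finsupp.mapRange.addMonoidHom (ι := σ) f.hom.toAddMonoidHom) :=
    Finsupp.mapRange_injective _ (map_zero _) hf
  intro q q' hq
  rw [← finsuppTens_tensFinsupp M σ q, ← finsuppTens_tensFinsupp M σ q']
  exact congrArg _ (h (by rw [← tensFinsupp_naturality, ← tensFinsupp_naturality, hq]))

/-- Projective modules are flat. -/
lemma tensMap_projective_injective {M M' : ModuleCat.{u} Λᵐᵒᵖ} (f : M ⟶ M')
    (hf : Function.Injective f.hom) (P : ModuleCat.{u} Λ) [Projective P] :
    Function.Injective (tensMap f (𝟙 P)) := by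
  -- `P` is a retract of the free module on its own underlying set, and injectivity passes to
  -- retracts.
  let p : ModuleCat.of Λ ((P : Type u) →₀ Λ) ⟶ P := ModuleCat.ofHom (Finsupp.linearCombination Λ id)
  have : Epi p := (ModuleCat.epi_iff_surjective _).2 (Finsupp.linearCombination_id_surjective Λ P)
  let s := Projective.factorThru (𝟙 P) p
  have hs : s ≫ p = 𝟙 P := Projective.factorThru_comp _ _
  have h1 : ∀ q, tensMap (𝟙 M) p (tensMap (𝟙 M) s q) = q := fun q =>
    (DFunLike.congr_fun (f := (tensMap (𝟙 M) p).comp (tensMap (𝟙 M) s)) (g := AddMonoidHom.id _)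
      (tens_hom_ext fun m x => congrArg (tmk m) (congrArg (fun k => k.hom x) hs)) q)
  have h2 : ∀ q, tensMap f (𝟙 _) (tensMap (𝟙 M) s q) = tensMap (𝟙 M') s (tensMap f (𝟙 P) q) :=
    fun q => (DFunLike.congr_fun (f := (tensMap f (𝟙 _)).comp (tensMap (𝟙 M) s))
      (g := (tensMap (𝟙 M') s).comp (tensMap f (𝟙 P))) (tens_hom_ext fun _ _ => rfl) q)
  intro q q' hq
  rw [← h1 q, ← h1 q']
  exact congrArg _ (tensMap_finsupp_injective f hf _ (by rw [h2, h2, hq]))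

instance (P : ModuleCat.{u} Λ) [Projective P] :
    ((tensorFunctor Λ).flip.obj P).PreservesMonomorphisms where
  preserves f hf := (AddCommGrpCat.mono_iff_injective _).2
    (tensMap_projective_injective f ((ModuleCat.mono_iff_injective _).1 hf) P)

/-- Right exactness and flatness together make `- ⊗ P` exact. -/
instance (P : ModuleCat.{u} Λ) [Projective P] :
    ((tensorFunctor Λ).flip.obj P).PreservesHomology :=
  Functor.preservesHomology_of_preservesMonos_and_cokernels _

/-- Tensor products are right exact as functors in the second variable. -/
lemma exactPair_map_tensorFunctor {M M' M'' : ModuleCat.{u} Λᵐᵒᵖ} {f : M ⟶ M'} {g : M' ⟶ M''}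
    [Epi g] (h : ExactPair f g) :
    ExactPair ((tensorFunctor Λ).map f) ((tensorFunctor Λ).map g) :=
  exactPair_of_app fun X => ⟨_, exact_map_tensorFunctor_flip_obj X (ShortComplex.mk f g h.1) h.2⟩

instance {M M' : ModuleCat.{u} Λᵐᵒᵖ} (g : M ⟶ M') [Epi g] : Epi ((tensorFunctor Λ).map g) := by
  have (X : ModuleCat.{u} Λ) : Epi (((tensorFunctor Λ).map g).app X) :=
    (AddCommGrpCat.epi_iff_surjective _).2 (tensMap_surjective g (𝟙 X)
      ((ModuleCat.epi_iff_surjective _).1 inferInstance) fun x => ⟨x, rfl⟩)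
  exact NatTrans.epi_of_epi_app _

end Tensor

/-! ### Opcycles as a cokernel, and the passage from `F` to its quotient. -/

section Opcycles

variable {D : Type u'} [Category.{v'} D] [Abelian D]
  {J : Type*} {c : ComplexShape J} (K : HomologicalComplex D c)

lemma exactPair_d_pOpcycles (i j : J) (hi : c.prev j = i) :
    ExactPair (K.d i j) (K.pOpcycles j) :=
  exactPair_of_up_to_refinements (K.d_pOpcycles i j) fun _ y hy =>
    (K.comp_pOpcycles_eq_zero_iff_up_to_refinements y i hi).1 hy

lemma exactPair_homologyι_fromOpcycles (i j : J) (hj : c.next i = j) :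
    ExactPair (K.homologyι i) (K.fromOpcycles i j) :=
  ⟨K.homologyι_comp_fromOpcycles i j,
    ShortComplex.exact_of_f_is_kernel _ (K.homologyIsKernel i j hj)⟩

lemma exactPair_fromOpcycles_pOpcycles (i j : J) (hi : c.prev j = i) :
    ExactPair (K.fromOpcycles i j) (K.pOpcycles j) :=
  exactPair_of_epi_comp (e := K.pOpcycles i)
    (by rw [K.p_fromOpcycles]; exact exactPair_d_pOpcycles K i j hi)

lemma isIso_descOpcycles {i j : J} (hi : c.prev j = i) {Y : D} (p : K.X j ⟶ Y) [Epi p]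
    (h : ExactPair (K.d i j) p) : IsIso (K.descOpcycles p i hi h.1) := by
  have : Epi (K.descOpcycles p i hi h.1) := epi_of_epi_fac (K.p_descOpcycles p i hi h.1)
  have : Mono (K.descOpcycles p i hi h.1) := by
    refine Preadditive.mono_of_cancel_zero _ fun {T} y hy => ?_
    obtain ⟨T₁, π₁, hπ₁, x, hx⟩ := surjective_up_to_refinements_of_epi (K.pOpcycles j) y
    obtain ⟨T₂, π₂, hπ₂, z, hz⟩ := h.up_to_refinements x (by
      rw [← K.p_descOpcycles p i hi h.1, ← Category.assoc, ← hx, Category.assoc, hy, comp_zero])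
    rw [← cancel_epi π₁, ← cancel_epi π₂, hx, ← Category.assoc, hz, Category.assoc,
      K.d_pOpcycles, comp_zero, comp_zero, comp_zero]
  exact isIso_of_mono_of_epi _

lemma descOpcycles_comp_eq_fromOpcycles {h i j : J} (hh : c.prev i = h) {Y : D} (p : K.X i ⟶ Y)
    (hp : K.d h i ≫ p = 0) (g : Y ⟶ K.X j) (hg : p ≫ g = K.d i j) :
    K.descOpcycles p h hh hp ≫ g = K.fromOpcycles i j := by
  rw [← cancel_epi (K.pOpcycles i), K.p_descOpcycles_assoc, hg, K.p_fromOpcycles]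

/-- If `F ⟶ O` is the kernel of `O ↠ B ⟶ C` and `L ⟶ F` lifts the kernel of `O ↠ B`, then the
cokernel of `L ⟶ F` is the kernel of `B ⟶ C`. -/
lemma exists_exactFour_of_cokernel {H L F O B C Z Q : D} {h : H ⟶ O} {q : O ⟶ B} [Epi q]
    (hq : ExactPair h q) {m : B ⟶ C} {p : C ⟶ Z} [Epi p] (hp : ExactPair m p) {ι : F ⟶ O} [Mono ι]
    (hι : ExactPair ι (q ≫ m)) (e : H ≅ L) {l : L ⟶ F} (hl : e.hom ≫ l ≫ ι = h) {s : F ⟶ Q}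
    [Epi s] (hs : ExactPair l s) : ∃ ι' : Q ⟶ B, s ≫ ι' = ι ≫ q ∧ ExactFour ι' m p := by
  have hlq : l ≫ ι ≫ q = 0 := by
    rw [← cancel_epi e.hom, ← Category.assoc l, ← Category.assoc, hl, hq.1, comp_zero]
  let ι' : Q ⟶ B := hs.2.desc (ι ≫ q) hlq
  have hι' : s ≫ ι' = ι ≫ q := hs.2.g_desc (ι ≫ q) hlq
  refine ⟨ι', hι', ?_, ?_, hp, inferInstance⟩
  · refine Preadditive.mono_of_cancel_zero _ fun {T} y hy => ?_
    obtain ⟨T₁, π₁, hπ₁, x, hx⟩ := surjective_up_to_refinements_of_epi s y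
    obtain ⟨T₂, π₂, hπ₂, z, hz⟩ := hq.up_to_refinements (x ≫ ι) (by
      rw [Category.assoc, ← hι', ← Category.assoc, ← hx, Category.assoc, hy, comp_zero])
    -- A representative `x` of an element of `ker ι'` has `x ≫ ι` in the kernel of `q`, hence in the
    -- image of `l ≫ ι`. As `ι` is monic, `x` comes from `L` and dies in `Q`.
    have hxz : π₂ ≫ x = z ≫ e.hom ≫ l := by
      rw [← cancel_mono ι, Category.assoc, hz, ← hl]
      simp only [Category.assoc]
    rw [← cancel_epi π₁, ← cancel_epi π₂, hx, ← Category.assoc, hxz]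
    simp [hs.1]
  · refine exactPair_of_up_to_refinements ?_ fun T y hy => ?_
    · rw [← cancel_epi s, ← Category.assoc, hι', Category.assoc, hι.1, comp_zero]
    · obtain ⟨T₁, π₁, hπ₁, x, hx⟩ := surjective_up_to_refinements_of_epi q y
      obtain ⟨T₂, π₂, hπ₂, z, hz⟩ := hι.up_to_refinements x (by
        rw [← Category.assoc, ← hx, Category.assoc, hy, comp_zero])
      refine ⟨T₂, π₂ ≫ π₁, inferInstance, z ≫ s, ?_⟩
      rw [Category.assoc, hx, ← Category.assoc, hz, Category.assoc, Category.assoc, hι']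

end Opcycles

/-! ### Left-derived natural transformations. -/

section LeftDerived

variable {A : Type u} [Category.{v} A] [Abelian A] [HasProjectiveResolutions A]
  {D : Type u'} [Category.{v'} D] [Abelian D] {F G : A ⥤ D} [F.Additive] [G.Additive] (α : F ⟶ G)

/-- A natural transformation that is invertible on projective objects induces isomorphisms of
left-derived functors. -/
lemma isIso_leftDerived (hα : ∀ (P : A) [Projective P], IsIso (α.app P)) (i : ℕ) :
    IsIso (NatTrans.leftDerived α i) := by
  have (X : A) : IsIso ((NatTrans.leftDerived α i).app X) := by
    -- The value at `X` is the homology of a map of complexes whose components are `α` at projective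
    -- objects.
    have := fun j => (projectiveResolution X).projective j
    have (j : ℕ) : IsIso (((NatTrans.mapHomologicalComplex α _).app
        (projectiveResolution X).complex).f j) :=
      hα ((projectiveResolution X).complex.X j)
    have : IsIso ((NatTrans.mapHomologicalComplex α _).app (projectiveResolution X).complex) :=
      HomologicalComplex.Hom.isIso_of_components _
    rw [(projectiveResolution X).leftDerived_app_eq]
    infer_instance
  exact NatIso.isIso_of_isIso_app _

/-- Naturality of `λ_F` in `F`. On opcycles both sides are induced by the augmentation `P_0 ⟶ X`, so
naturality of `α` there suffices. -/
lemma leftDerived_zero_comp_fromLeftDerivedZero :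
    NatTrans.leftDerived α 0 ≫ G.fromLeftDerivedZero = F.fromLeftDerivedZero ≫ α := by
  ext X
  let P := projectiveResolution X
  let φ := (NatTrans.mapHomologicalComplex α (ComplexShape.down ℕ)).app P.complex
  have h1 : HomologicalComplex.opcyclesMap φ 0 ≫ P.fromLeftDerivedZero' G =
      P.fromLeftDerivedZero' F ≫ α.app X := by
    refine (cancel_epi (HomologicalComplex.pOpcycles _ _)).1 ?_
    rw [HomologicalComplex.p_opcyclesMap_assoc, P.pOpcycles_comp_fromLeftDerivedZero',
      P.pOpcycles_comp_fromLeftDerivedZero'_assoc]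
    exact (α.naturality (P.π.f 0)).symm
  have h2 : HomologicalComplex.homologyMap φ 0 ≫ HomologicalComplex.homologyι _ 0 ≫
      P.fromLeftDerivedZero' G =
      HomologicalComplex.homologyι _ 0 ≫ P.fromLeftDerivedZero' F ≫ α.app X := by
    rw [HomologicalComplex.homologyι_naturality_assoc, h1]
  rw [NatTrans.comp_app, NatTrans.comp_app, P.leftDerived_app_eq α 0,
    P.fromLeftDerivedZero_eq F, P.fromLeftDerivedZero_eq G]
  simp only [Category.assoc, Iso.inv_hom_id_assoc]
  exact congrArg (_ ≫ ·) (h2.trans (Category.assoc _ _ _).symm)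

end LeftDerived

/-! ### The functor `H_n(C ⊗ -)`: its copresentations and its derived functors. -/

section Tensor

variable {Λ : Type u} [Ring Λ] (C : ChainComplex (ModuleCat.{u} Λᵐᵒᵖ) ℤ) (n : ℤ)

instance (X : ModuleCat.{u} Λ) {M M' : ModuleCat.{u} Λᵐᵒᵖ} (f : M ⟶ M') [Epi f] :
    Epi (((tensorFunctor Λ).map f).app X) :=
  inferInstanceAs (Epi (((evaluation _ _).obj X).map ((tensorFunctor Λ).map f)))

lemma exactPair_complexTensor_d (X : ModuleCat.{u} Λ) (i j : ℤ)
    (hi : (ComplexShape.down ℤ).prev j = i) :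
    ExactPair (((complexTensor C).obj X).d i j) (((tensorFunctor Λ).map (C.pOpcycles j)).app X) :=
  (exactPair_map_tensorFunctor (exactPair_d_pOpcycles C i j hi)).app X

/-- The isomorphism between the opcycles of `C ⊗ X` and `C_n / B_n ⊗ X`. -/
def opcyclesTensor (X : ModuleCat.{u} Λ) :
    ((complexTensor C).obj X).opcycles n ⟶ ((tensorFunctor Λ).obj (C.opcycles n)).obj X :=
  ((complexTensor C).obj X).descOpcycles (((tensorFunctor Λ).map (C.pOpcycles n)).app X) _ rfl
    (exactPair_complexTensor_d C X _ n rfl).1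

instance (X : ModuleCat.{u} Λ) : IsIso (opcyclesTensor C n X) :=
  have h : Epi (((tensorFunctor Λ).map (C.pOpcycles n)).app X) := inferInstance
  @isIso_descOpcycles _ _ _ _ _ _ _ _ rfl _ _ h (exactPair_complexTensor_d C X _ n rfl)

lemma pOpcycles_opcyclesTensor (X : ModuleCat.{u} Λ) :
    ((complexTensor C).obj X).pOpcycles n ≫ opcyclesTensor C n X =
      ((tensorFunctor Λ).map (C.pOpcycles n)).app X :=
  HomologicalComplex.p_descOpcycles _ _ _ _ _

lemma opcyclesTensor_naturality {X Y : ModuleCat.{u} Λ} (f : X ⟶ Y) :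
    HomologicalComplex.opcyclesMap ((complexTensor C).map f) n ≫ opcyclesTensor C n Y =
      opcyclesTensor C n X ≫ ((tensorFunctor Λ).obj (C.opcycles n)).map f := by
  rw [← cancel_epi (((complexTensor C).obj X).pOpcycles n),
    HomologicalComplex.p_opcyclesMap_assoc, pOpcycles_opcyclesTensor, ← Category.assoc,
    pOpcycles_opcyclesTensor]
  exact ((tensorFunctor Λ).map (C.pOpcycles n)).naturality f

lemma opcyclesTensor_fromOpcycles (X : ModuleCat.{u} Λ) (j : ℤ) :
    opcyclesTensor C n X ≫ ((tensorFunctor Λ).map (C.fromOpcycles n j)).app X =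
      ((complexTensor C).obj X).fromOpcycles n j :=
  descOpcycles_comp_eq_fromOpcycles _ _ _ _ _ (congr_app (((tensorFunctor Λ).map_comp _ _).symm.trans
    (congrArg (tensorFunctor Λ).map (C.p_fromOpcycles n j))) X)

/-- The canonical map `H_n(C ⊗ -) ⟶ C_n / B_n ⊗ -`. -/
def homologyTensorι : homologyTensor C n ⟶ (tensorFunctor Λ).obj (C.opcycles n) where
  app X := ((complexTensor C).obj X).homologyι n ≫ opcyclesTensor C n X
  naturality X Y f := by
    refine (HomologicalComplex.homologyι_naturality_assoc _ _ _).trans ?_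
    rw [opcyclesTensor_naturality]
    exact (Category.assoc _ _ _).symm

lemma homologyTensorι_app (X : ModuleCat.{u} Λ) : (homologyTensorι C n).app X =
    ((complexTensor C).obj X).homologyι n ≫ opcyclesTensor C n X := rfl

lemma homologyπ_homologyTensorι_app (X : ModuleCat.{u} Λ) :
    ((complexTensor C).obj X).homologyπ n ≫ (homologyTensorι C n).app X =
      ((complexTensor C).obj X).iCycles n ≫ ((tensorFunctor Λ).map (C.pOpcycles n)).app X := by
  rw [homologyTensorι_app, HomologicalComplex.homology_π_ι_assoc, pOpcycles_opcyclesTensor]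

instance (X : ModuleCat.{u} Λ) : Mono ((homologyTensorι C n).app X) :=
  inferInstanceAs (Mono (((complexTensor C).obj X).homologyι n ≫ opcyclesTensor C n X))

instance : Mono (homologyTensorι C n) := NatTrans.mono_of_mono_app _

lemma exactPair_homologyTensorι : ExactPair (homologyTensorι C n)
    ((tensorFunctor Λ).map (C.fromOpcycles n (n - 1))) :=
  exactPair_of_app fun X => by
    have h := exactPair_conj_iso (exactPair_homologyι_fromOpcycles ((complexTensor C).obj X)
      n (n - 1) (by simp)) (asIso (opcyclesTensor C n X)).symm
    have h' : (asIso (opcyclesTensor C n X)).symm.hom ≫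
        ((complexTensor C).obj X).fromOpcycles n (n - 1) =
          ((tensorFunctor Λ).map (C.fromOpcycles n (n - 1))).app X :=
      (Iso.inv_comp_eq _).2 (opcyclesTensor_fromOpcycles C n X (n - 1)).symm
    rw [h'] at h
    exact h

lemma exactFour_homologyTensorι : ExactFour (homologyTensorι C n)
    ((tensorFunctor Λ).map (C.fromOpcycles n (n - 1)))
    ((tensorFunctor Λ).map (C.pOpcycles (n - 1))) :=
  ⟨inferInstance, exactPair_homologyTensorι C n, exactPair_map_tensorFunctor
    (exactPair_fromOpcycles_pOpcycles C n (n - 1) (by simp)), inferInstance⟩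

/-- The canonical map `H_n(C) ⊗ - ⟶ H_n(C ⊗ -)`. -/
def tensorHomology : (tensorFunctor Λ).obj (C.homology n) ⟶ homologyTensor C n :=
  (exactPair_homologyTensorι C n).2.lift ((tensorFunctor Λ).map (C.homologyι n)) (by
    change (tensorFunctor Λ).map _ ≫ (tensorFunctor Λ).map _ = 0
    rw [← Functor.map_comp, HomologicalComplex.homologyι_comp_fromOpcycles, Functor.map_zero])

lemma tensorHomology_ι :
    tensorHomology C n ≫ homologyTensorι C n = (tensorFunctor Λ).map (C.homologyι n) :=
  (exactPair_homologyTensorι C n).2.lift_f _ _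

lemma tensorHomology_app_ι (X : ModuleCat.{u} Λ) :
    (tensorHomology C n).app X ≫ (homologyTensorι C n).app X =
      ((tensorFunctor Λ).map (C.homologyι n)).app X :=
  congr_app (tensorHomology_ι C n) X

/-- Tensoring with the flat module `P` keeps `H_n(C)` the kernel of `C_n/B_n ⟶ C_(n-1)`, and `H_n(C
⊗ P)` is also that kernel. -/
lemma isIso_tensorHomology_app (P : ModuleCat.{u} Λ) [Projective P] :
    IsIso ((tensorHomology C n).app P) := by
  have h0 := exactPair_homologyι_fromOpcycles C n (n - 1) (by simp)
  have h : ExactPair (((tensorFunctor Λ).map (C.homologyι n)).app P)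
      (((tensorFunctor Λ).map (C.fromOpcycles n (n - 1))).app P) :=
    ⟨_, h0.2.map ((tensorFunctor Λ).flip.obj P)⟩
  have hm : Mono (((tensorFunctor Λ).map (C.homologyι n)).app P) :=
    ((tensorFunctor Λ).flip.obj P).map_mono (C.homologyι n)
  have h1 : Mono ((tensorHomology C n).app P) := by
    rw [← tensorHomology_app_ι] at hm
    exact mono_of_mono _ ((homologyTensorι C n).app P)
  have h2 : Epi ((tensorHomology C n).app P) := by
    refine (epi_iff_surjective_up_to_refinements _).2 fun T y => ?_
    obtain ⟨T', π, hπ, x, hx⟩ := h.up_to_refinements (y ≫ (homologyTensorι C n).app P) (by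
      rw [Category.assoc, ((exactPair_homologyTensorι C n).app P).1, comp_zero])
    refine ⟨T', π, hπ, x, ?_⟩
    rw [← cancel_mono ((homologyTensorι C n).app P), Category.assoc, hx, Category.assoc,
      tensorHomology_app_ι]
  exact isIso_of_mono_of_epi _

/-- The isomorphism of left-derived functors induced by `H_n(C) ⊗ - ⟶ H_n(C ⊗ -)`. -/
def leftDerivedTensorIso (i : ℕ) : ((tensorFunctor Λ).obj (C.homology n)).leftDerived i ≅
    (homologyTensor C n).leftDerived i :=
  have := isIso_leftDerived (tensorHomology C n) (isIso_tensorHomology_app C n) i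
  asIso (NatTrans.leftDerived (tensorHomology C n) i)

/-- The isomorphism between `H_n(C) ⊗ -` and the zeroth left-derived functor of `H_n(C ⊗ -)`. -/
def tensorIsoLeftDerivedZero :
    (tensorFunctor Λ).obj (C.homology n) ≅ (homologyTensor C n).leftDerived 0 :=
  ((tensorFunctor Λ).obj (C.homology n)).leftDerivedZeroIsoSelf.symm ≪≫ leftDerivedTensorIso C n 0

/-- Naturality of `λ` moves `κ` past it, and `λ` is invertible for the right exact functor `H_n(C) ⊗
-`. -/
lemma tensorIsoLeftDerivedZero_hom :
    (tensorIsoLeftDerivedZero C n).hom ≫ (homologyTensor C n).fromLeftDerivedZero =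
      tensorHomology C n := by
  simp only [tensorIsoLeftDerivedZero, leftDerivedTensorIso, Iso.trans_hom, Iso.symm_hom,
    asIso_hom, Category.assoc]
  rw [leftDerived_zero_comp_fromLeftDerivedZero,
    Functor.leftDerivedZeroIsoSelf_inv_hom_id_assoc]

/-- The identification of the left-derived functors of `H_n(C ⊗ -)`. -/
def torIsoLeftDerived : ∀ i : ℕ, torFunctor (C.homology n) i ≅ (homologyTensor C n).leftDerived i
  | 0 => tensorIsoLeftDerivedZero C n
  | i + 1 => leftDerivedTensorIso C n (i + 1)

lemma opcyclesToBoundaries_ι :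
    opcyclesToBoundaries C n ≫ image.ι (C.d n (n - 1)) = C.fromOpcycles n (n - 1) := by
  rw [← cancel_epi (C.pOpcycles n), opcyclesToBoundaries, HomologicalComplex.p_descOpcycles_assoc,
    image.fac, HomologicalComplex.p_fromOpcycles]

instance : Epi (opcyclesToBoundaries C n) :=
  epi_of_epi_fac (f := C.pOpcycles n) (h := factorThruImage (C.d n (n - 1)))
    (HomologicalComplex.p_descOpcycles _ _ _ _ _)

lemma exactPair_homologyι_opcyclesToBoundaries :
    ExactPair (C.homologyι n) (opcyclesToBoundaries C n) :=
  exactPair_of_comp_mono (j := image.ι (C.d n (n - 1))) (by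
    rw [opcyclesToBoundaries_ι]
    exact exactPair_homologyι_fromOpcycles C n (n - 1) (by simp))

lemma exactPair_image_ι_pOpcycles :
    ExactPair (image.ι (C.d n (n - 1))) (C.pOpcycles (n - 1)) :=
  exactPair_of_epi_comp (e := factorThruImage (C.d n (n - 1))) (by
    rw [image.fac]
    exact exactPair_d_pOpcycles C n (n - 1) (by simp))

/-- The map `C_n/B_n ⟶ C_(n-1)` is split into `C_n/B_n ↠ B_(n-1) ↪ C_(n-1)`. After tensoring the
second map need not be monic, and its kernel is the quot-stabilization. -/
lemma exists_exactFour_quotStab : ∃ ι' : quotStab (homologyTensor C n) ⟶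
      (tensorFunctor Λ).obj (boundaries C n),
    quotStabπ (homologyTensor C n) ≫ ι' =
      homologyTensorι C n ≫ (tensorFunctor Λ).map (opcyclesToBoundaries C n) ∧
    ExactFour ι' ((tensorFunctor Λ).map (image.ι (C.d n (n - 1))))
      ((tensorFunctor Λ).map (C.pOpcycles (n - 1))) := by
  refine exists_exactFour_of_cokernel
    (exactPair_map_tensorFunctor (exactPair_homologyι_opcyclesToBoundaries C n))
    (exactPair_map_tensorFunctor (exactPair_image_ι_pOpcycles C n)) ?_
    (tensorIsoLeftDerivedZero C n) ?_ (exactPair_fromLeftDerivedZero_quotStabπ (homologyTensor C n))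
  · rw [← Functor.map_comp, opcyclesToBoundaries_ι]
    exact exactPair_homologyTensorι C n
  · rw [← tensorHomology_ι, ← tensorIsoLeftDerivedZero_hom, Category.assoc]

end Tensor
end FundamentalSequence
end

theorem mainTheorem7 {Λ : Type u} [Ring Λ] (C : ChainComplex (ModuleCat.{u} Λᵐᵒᵖ) ℤ) (n : ℤ)
    (R : ∀ B : ModuleCat.{u} Λ, ProjectiveResolution B) :
    ∃ (ι : homologyTensor C n ⟶ (tensorFunctor Λ).obj (C.opcycles n))
      (ι' : quotStab (homologyTensor C n) ⟶ (tensorFunctor Λ).obj (boundaries C n))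
      (κ : (tensorFunctor Λ).obj (C.homology n) ⟶ homologyTensor C n)
      (φ : ∀ i : ℕ, torFunctor (C.homology n) i ≅ (homologyTensor C n).leftDerived i),
      -- the tensor copresentation of `H_n(C ⊗ -)`, with the canonical maps
      (∀ X : ModuleCat.{u} Λ,
        ((complexTensor C).obj X).homologyπ n ≫ ι.app X =
          ((complexTensor C).obj X).iCycles n ≫ ((tensorFunctor Λ).map (C.pOpcycles n)).app X) ∧
      ExactFour ι ((tensorFunctor Λ).map (C.fromOpcycles n (n - 1)))
        ((tensorFunctor Λ).map (C.pOpcycles (n - 1))) ∧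
      -- the tensor copresentation of its quot-stabilization
      quotStabπ (homologyTensor C n) ≫ ι' =
        ι ≫ (tensorFunctor Λ).map (opcyclesToBoundaries C n) ∧
      ExactFour ι' ((tensorFunctor Λ).map (image.ι (C.d n (n - 1))))
        ((tensorFunctor Λ).map (C.pOpcycles (n - 1))) ∧
      -- the identification of the left-derived functors, induced by the canonical map `κ`
      κ ≫ ι = (tensorFunctor Λ).map (C.homologyι n) ∧
      (φ 0).hom ≫ (homologyTensor C n).fromLeftDerivedZero = κ ∧
      (∀ i : ℕ, (φ (i + 1)).hom = NatTrans.leftDerived κ (i + 1)) ∧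
      -- the left fundamental sequence, rewritten through this identification
      ((leftFundamentalSequence (homologyTensor C n) R).replaceL _ φ).IsComplex ∧
      ((leftFundamentalSequence (homologyTensor C n) R).replaceL _ φ).ExactOffL ∧
      (HalfExact (homologyTensor C n) →
        ((leftFundamentalSequence (homologyTensor C n) R).replaceL _ φ).IsExact) :=
  let ⟨ι', h, h'⟩ := exists_exactFour_quotStab C n
  ⟨homologyTensorι C n, ι', tensorHomology C n, torIsoLeftDerived C n,
    homologyπ_homologyTensorι_app C n, exactFour_homologyTensorι C n, h, h',
    tensorHomology_ι C n, tensorIsoLeftDerivedZero_hom C n, fun _ => rfl,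
    (leftFundamentalSequence_isComplex _ R).replaceL _ _,
    (leftFundamentalSequence_exactOffL _ R).replaceL _ _,
    fun hF => (leftFundamentalSequence_isExact _ R hF).replaceL _ _⟩
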